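/- Rings are associative and unital, not necessarily commutative, and homomorphisms preserve $1$. For a ring $A$ and a subset $S\subseteq A$ let $A_S$ be the universal ring under $A$ in which the elements of $S$ become invertible; $U(B)$ is the group of units and $J(B)$ the Jacobson radical of a ring $B$. *Affine F-schemes.* A homomorphism $\phi:A\to B$ to a nonzero ring yields a sequence $\mathcal S=(S_1,S_2,\dots)$ by $A_0=A$, $\phi_0=\phi$, $S_{n+1}=\phi_n^{-1}(U(B))$, $A_{n+1}=(A_n)_{S_{n+1}}$, with $\phi_{n+1}:A_{n+1}\to B$ the extension of $\phi_n$. Such a sequence is called a fully invertible system on $A$, and $F(A)$ is the set of all of them. A fraction of $A$ is a tuple $\mathbf a=(a_1,\dots,a_n)$ with $a_1\in A$, $a_2\in A_{a_1}$, $a_3\in (A_{a_1})_{a_2}$, and so on; $A_{\mathbf a}=(\cdots(A_{a_1})_{a_2}\cdots)_{a_n}$. The topology of $F(A)$ has as a base the sets $D(\mathbf a)$ of all $\mathcal S=(S_1,S_2,\dots)$ with $a_i\in S_i$ for $1\le i\le n$. The structure sheaf is $\mathcal O_A(U)=\varprojlim_{D(\mathbf a)\subseteq U}A_{\mathbf a}$.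 For an $A$-bimodule $N$, $\widehat N$ is the sheaf of $\mathcal O_A$-bimodules $\widehat N(U)=\varprojlim_{D(\mathbf a)\subseteq U}A_{\mathbf a}\otimes_A N\otimes_A A_{\mathbf a}$. An F-scheme is a ringed space (with sheaf of possibly noncommutative rings) in which every point has an open neighbourhood isomorphic as a ringed space to $F(A)$ for some ring $A$. *Quasi-coherent ideals.* Let $X$ be an F-scheme. A sheaf of two-sided ideals $\mathcal I\subseteq\mathcal O_X$ is quasi-coherent if $X$ is covered by open subsets $U\cong F(A)$ such that $\mathcal I|_U\cong\widehat N$ as sheaves of bimodules for some $A$-bimodule $N$. Put $$Z(\mathcal I)=\{x\in X\mid \mathcal I_x\subseteq J(\mathcal O_{X,x})\}$$ with the subspace topology, and let $(Z(\mathcal I),\mathcal O_X/\mathcal I)$ be the ringed space whose structure sheaf is the restriction (inverse image) of the quotient sheaf $\mathcal O_X/\mathcal I$ to $Z(\mathcal I)$. **Proposition.** If $\mathcal I$ is a quasi-coherent sheaf of two-sided ideals on an F-scheme $X$, then $(Z(\mathcal I),\mathcal O_X/\mathcal I)$ is an F-scheme. In the affine case $X=F(A)$, let $I\subseteq A$ be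 the two-sided ideal $\Gamma(F(A),\mathcal I)$ of $A=\Gamma(F(A),\mathcal O_A)$; then $(Z(\mathcal I),\mathcal O_A/\mathcal I)\cong F(A/I)$ as ringed spaces. Likewise, for every two-sided ideal $I$ of a ring $A$ and the sheaf of ideals $\mathcal I$ on $F(A)$ generated by $I$ (the image of the canonical map $\widehat I\to\mathcal O_A$), $(Z(\mathcal I),\mathcal O_A/\mathcal I)\cong F(A/I)$. -/

import Mathlib

open CategoryTheory TopologicalSpace Opposite AlgebraicGeometry
open scoped TensorProduct

universe u

namespace FSch

noncomputable section

/-! ### Universal localization of a (noncommutative) ring -/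

/-- Relations presenting `⟨A, (x_s)_{s ∈ S} | x_s s = s x_s = 1⟩`: the first three make `A` map to
the quotient by a ring homomorphism, the last two make `x_s` inverse to `s`. -/
inductive LocRel (A : Type u) [Ring A] (S : Set A) :
    FreeAlgebra ℤ (A ⊕ S) → FreeAlgebra ℤ (A ⊕ S) → Prop
  | one : LocRel A S (FreeAlgebra.ι ℤ (Sum.inl 1)) 1
  | add (a b : A) : LocRel A S (FreeAlgebra.ι ℤ (Sum.inl (a + b)))
      (FreeAlgebra.ι ℤ (Sum.inl a) + FreeAlgebra.ι ℤ (Sum.inl b))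
  | mul (a b : A) : LocRel A S (FreeAlgebra.ι ℤ (Sum.inl (a * b)))
      (FreeAlgebra.ι ℤ (Sum.inl a) * FreeAlgebra.ι ℤ (Sum.inl b))
  | inv_mul (s : S) : LocRel A S
      (FreeAlgebra.ι ℤ (Sum.inr s) * FreeAlgebra.ι ℤ (Sum.inl s.1)) 1
  | mul_inv (s : S) : LocRel A S
      (FreeAlgebra.ι ℤ (Sum.inl s.1) * FreeAlgebra.ι ℤ (Sum.inr s)) 1

/-- The localization `A_S` of `A` at an arbitrary subset `S`. -/
def Loc (A : Type u) [Ring A] (S : Set A) : Type u := RingQuot (LocRel A S)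

instance (A : Type u) [Ring A] (S : Set A) : Ring (Loc A S) :=
  inferInstanceAs (Ring (RingQuot (LocRel A S)))

/-- The localization `A_S` as an object of the category of rings. -/
def loc (A : RingCat.{u}) (S : Set A) : RingCat.{u} := RingCat.of (Loc A S)

section Loc

variable (A : Type u) [Ring A] (S : Set A)

/-- The quotient map from the free ring on the generators onto `A_S`. -/
def Loc.mk : FreeAlgebra ℤ (A ⊕ S) →+* Loc A S := RingQuot.mkRingHom (LocRel A S)

theorem Loc.mk_rel {x y : FreeAlgebra ℤ (A ⊕ S)} (h : LocRel A S x y) :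
    Loc.mk A S x = Loc.mk A S y := RingQuot.mkRingHom_rel h

/-- The localization homomorphism `A → A_S`. -/
def Loc.map : A →+* Loc A S where
  toFun a := Loc.mk A S (FreeAlgebra.ι ℤ (Sum.inl a))
  map_one' := by rw [Loc.mk_rel A S LocRel.one, map_one]
  map_mul' a b := by rw [Loc.mk_rel A S (LocRel.mul a b), map_mul]
  map_add' a b := by rw [Loc.mk_rel A S (LocRel.add a b), map_add]
  map_zero' := by
    have := Loc.mk_rel A S (LocRel.add 0 0)
    rw [add_zero, map_add] at this
    exact left_eq_add.1 this

theorem Loc.inv_mul (s : S) :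
    Loc.mk A S (FreeAlgebra.ι ℤ (Sum.inr s)) * Loc.map A S s.1 = 1 := by
  rw [← map_one (Loc.mk A S), ← Loc.mk_rel A S (LocRel.inv_mul s), map_mul]; rfl

theorem Loc.mul_inv (s : S) :
    Loc.map A S s.1 * Loc.mk A S (FreeAlgebra.ι ℤ (Sum.inr s)) = 1 := by
  rw [← map_one (Loc.mk A S), ← Loc.mk_rel A S (LocRel.mul_inv s), map_mul]; rfl

theorem Loc.isUnit_map {s : A} (hs : s ∈ S) : IsUnit (Loc.map A S s) :=
  ⟨⟨_, _, Loc.mul_inv A S ⟨s, hs⟩, Loc.inv_mul A S ⟨s, hs⟩⟩, rfl⟩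

variable {A S} {B : Type u} [Ring B]

/-- The universal property of `A_S`, existence. -/
def Loc.lift (φ : A →+* B) (h : ∀ s ∈ S, IsUnit (φ s)) : Loc A S →+* B :=
  RingQuot.lift (r := LocRel A S)
    ⟨(FreeAlgebra.lift ℤ (Sum.elim (fun a : A => φ a)
        (fun s : S => (((h s.1 s.2).unit⁻¹ : Bˣ) : B))) : FreeAlgebra ℤ (A ⊕ S) →ₐ[ℤ] B).toRingHom,
      by intro x y hxy; cases hxy <;> simp⟩

theorem Loc.lift_comp (φ : A →+* B) (h : ∀ s ∈ S, IsUnit (φ s)) :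
    (Loc.lift φ h).comp (Loc.map A S) = φ := by
  ext a
  refine (RingQuot.lift_mkRingHom_apply (r := LocRel A S) _ _ _).trans ?_
  simp

/-- The universal property of `A_S`, uniqueness. -/
theorem Loc.hom_ext {f g : Loc A S →+* B}
    (h : f.comp (Loc.map A S) = g.comp (Loc.map A S)) : f = g := by
  refine RingQuot.ringQuot_ext (r := LocRel A S) f g ?_
  have : (f.comp (Loc.mk A S)).toIntAlgHom = (g.comp (Loc.mk A S)).toIntAlgHom := by
    apply FreeAlgebra.hom_ext
    funext x
    rcases x with a | s
    · exact RingHom.congr_fun h a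
    · have e1 := congrArg f (Loc.inv_mul A S s)
      have e2 := congrArg g (Loc.mul_inv A S s)
      rw [map_mul, map_one] at e1 e2
      rw [show f (Loc.map A S s.1) = g (Loc.map A S s.1) from RingHom.congr_fun h s.1] at e1
      exact left_inv_eq_right_inv e1 e2
  exact RingHom.ext fun x => DFunLike.congr_fun this x

end Loc

/-! ### Fully invertible systems -/

/-- The finite sequences `(S₁, …, Sₙ)` with `Sᵢ ⊆ A_{i-1}`, where `A₀ = A` and
`Aᵢ = (A_{i-1})_{Sᵢ}`, together with the ring `Aₙ` attached to such a sequence. -/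
def chainAux (A : RingCat.{u}) : ℕ → Σ T : Type u, (T → RingCat.{u})
  | 0 => ⟨PUnit, fun _ => A⟩
  | n + 1 => ⟨Σ s : (chainAux A n).1, Set ((chainAux A n).2 s),
      fun s => loc ((chainAux A n).2 s.1) s.2⟩

/-- The type of sequences `(S₁, …, Sₙ)` of subsets of successive localizations of `A`. -/
def Chain (A : RingCat.{u}) (n : ℕ) : Type u := (chainAux A n).1

/-- The ring `A_{𝒮,n}` obtained from `A` by localizing successively at `S₁, …, Sₙ`. -/
def Chain.ring {A : RingCat.{u}} {n : ℕ} (s : Chain A n) : RingCat.{u} := (chainAux A n).2 s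

/-- The initial segment `(S₁, …, Sₙ)` of `(S₁, …, Sₙ₊₁)`. -/
def Chain.init {A : RingCat.{u}} {n : ℕ} (s : Chain A (n + 1)) : Chain A n := Sigma.fst s

/-- The last entry `Sₙ₊₁ ⊆ A_{𝒮,n}` of `(S₁, …, Sₙ₊₁)`. -/
def Chain.last {A : RingCat.{u}} {n : ℕ} (s : Chain A (n + 1)) : Set s.init.ring := Sigma.snd s

/-- Append a subset `S ⊆ A_{𝒮,n}`. -/
def Chain.snoc {A : RingCat.{u}} {n : ℕ} (s : Chain A n) (S : Set s.ring) : Chain A (n + 1) :=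
  ⟨s, S⟩

/-- The localization map `A_{𝒮,n} → A_{𝒮,n+1}`. -/
def Chain.step {A : RingCat.{u}} {n : ℕ} (s : Chain A (n + 1)) : s.init.ring →+* s.ring :=
  Loc.map s.init.ring s.last

/-- Given `φ : A → B`, the sequence `(S₁, …, Sₙ)` and the extension `φₙ : A_{𝒮,n} → B` of `φ`,
where inductively `Sₙ₊₁ = φₙ⁻¹(U(B))` and `φₙ₊₁` is induced by `φₙ`. -/
def chainOfHom (A : RingCat.{u}) {B : Type u} [Ring B] (φ : A →+* B) :
    ∀ n : ℕ, Σ s : Chain A n, (s.ring →+* B)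
  | 0 => ⟨PUnit.unit, φ⟩
  | n + 1 =>
    ⟨(chainOfHom A φ n).1.snoc {x | IsUnit ((chainOfHom A φ n).2 x)},
      Loc.lift (chainOfHom A φ n).2 fun _ hs => hs⟩

theorem chainOfHom_comp_step (A : RingCat.{u}) {B : Type u} [Ring B] (φ : A →+* B) (n : ℕ) :
    (chainOfHom A φ (n + 1)).2.comp (chainOfHom A φ (n + 1)).1.step = (chainOfHom A φ n).2 :=
  Loc.lift_comp (chainOfHom A φ n).2 fun _ hs => hs

/-- The full spectrum `F(A)`: the set of fully invertible systems `𝒮 = (S₁, S₂, …)` on `A`, i.e.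
the sequences coming from a homomorphism of `A` to a nonzero ring. The infinite sequence is given
by its initial segments `(S₁, …, Sₙ)`. -/
def FullSpec (A : RingCat.{u}) : Type u :=
  {s : ∀ n, Chain A n // ∃ (B : RingCat.{u}) (_ : Nontrivial B) (φ : A →+* B),
    ∀ n, s n = (chainOfHom A φ n).1}

/-- The fully invertible system coming from a homomorphism to a nonzero ring. -/
def FullSpec.ofHom {A B : RingCat.{u}} [Nontrivial B] (φ : A →+* B) : FullSpec A :=
  ⟨fun n => (chainOfHom A φ n).1, B, ‹_›, φ, fun _ => rfl⟩

/-! ### Fractions and the topology of `F(A)` -/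

/-- The fractions `(a₁, …, aₙ)` of `A` of length `n`, `aᵢ ∈ A_{i-1}`, where `A₀ = A` and
`Aᵢ = (A_{i-1})_{aᵢ}`, together with the ring `Aₙ` attached to such a fraction. -/
def fracAux (A : RingCat.{u}) : ℕ → Σ T : Type u, (T → RingCat.{u})
  | 0 => ⟨PUnit, fun _ => A⟩
  | n + 1 => ⟨Σ a : (fracAux A n).1, (fracAux A n).2 a,
      fun a => loc ((fracAux A n).2 a.1) {a.2}⟩

/-- Fractions of length `n` (the empty fraction, `n = 0`, plays the role of the fraction `(1)`). -/
def FracN (A : RingCat.{u}) (n : ℕ) : Type u := (fracAux A n).1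

/-- The ring `A_𝐚`. -/
def FracN.ring {A : RingCat.{u}} {n : ℕ} (a : FracN A n) : RingCat.{u} := (fracAux A n).2 a

/-- The fraction `(a₁, …, aₙ)` underlying `(a₁, …, aₙ₊₁)`. -/
def FracN.init {A : RingCat.{u}} {n : ℕ} (a : FracN A (n + 1)) : FracN A n := Sigma.fst a

/-- The last entry of `(a₁, …, aₙ₊₁)`. -/
def FracN.last {A : RingCat.{u}} {n : ℕ} (a : FracN A (n + 1)) : a.init.ring := Sigma.snd a

/-- The localization map `A_{𝐚,n} → A_{𝐚,n+1}`. -/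
def FracN.step {A : RingCat.{u}} {n : ℕ} (a : FracN A (n + 1)) : a.init.ring →+* a.ring :=
  Loc.map a.init.ring {a.last}

/-- The natural map `A → A_𝐚`. -/
def FracN.map {A : RingCat.{u}} : ∀ {n : ℕ} (a : FracN A n), A →+* a.ring
  | 0, _ => RingHom.id A
  | _ + 1, a => a.step.comp (FracN.map a.init)

/-- `IsNat a s h` says that `h` is the natural map `A_𝐚 → A_{𝒮,n}`, which exists if and only if
`aᵢ ∈ Sᵢ` for `1 ≤ i ≤ n` (where `aᵢ` is viewed in `A_{𝒮,i-1}` via the natural map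
`A_{𝐚,i-1} → A_{𝒮,i-1}`). -/
def IsNat {A : RingCat.{u}} : ∀ {n : ℕ} (a : FracN A n) (s : Chain A n),
    (a.ring →+* s.ring) → Prop
  | 0, _, _, h => h = RingHom.id A
  | _ + 1, a, s, h => ∃ h₀ : a.init.ring →+* s.init.ring, IsNat a.init s.init h₀ ∧
      h₀ a.last ∈ s.last ∧ h.comp a.step = s.step.comp h₀

/-- A fraction of `A`, of any length. -/
def Fraction (A : RingCat.{u}) : Type u := Σ n : ℕ, FracN A n

namespace Fraction

variable {A : RingCat.{u}}

/-- The ring `A_𝐚`. -/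
def ring (a : Fraction A) : RingCat.{u} := a.2.ring

/-- The natural map `A → A_𝐚`. -/
def map (a : Fraction A) : A →+* a.ring := a.2.map

/-- `D(𝐚)`: the set of fully invertible systems `𝒮` with `aᵢ ∈ Sᵢ` for all `i`. -/
def D (a : Fraction A) : Set (FullSpec A) :=
  {S | ∃ h : a.2.ring →+* (S.1 a.1).ring, IsNat a.2 (S.1 a.1) h}

end Fraction

/-- The topology of `F(A)` generated by the sets `D(𝐚)` (which form a base of it). -/
instance (A : RingCat.{u}) : TopologicalSpace (FullSpec A) :=
  TopologicalSpace.generateFrom (Set.range (Fraction.D (A := A)))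

theorem FracN.hom_ext {A : RingCat.{u}} {B : Type u} [Ring B] : ∀ {n : ℕ} (a : FracN A n)
    {f g : a.ring →+* B}, f.comp a.map = g.comp a.map → f = g
  | 0, _, _, _, h => h
  | _ + 1, a, _, _, h => Loc.hom_ext (FracN.hom_ext a.init h)

theorem exists_isNat_iff {A : RingCat.{u}} {B : Type u} [Ring B] (φ : A →+* B) :
    ∀ {n : ℕ} (a : FracN A n), (∃ h, IsNat a (chainOfHom A φ n).1 h ∧
        ((chainOfHom A φ n).2.comp h).comp a.map = φ) ↔ ∃ k : a.ring →+* B, k.comp a.map = φ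
  | 0, a => ⟨fun ⟨h, _, e⟩ => ⟨_, e⟩, fun _ => ⟨RingHom.id A, rfl, rfl⟩⟩
  | n + 1, a => by
    constructor
    · rintro ⟨h, _, e⟩
      exact ⟨_, e⟩
    · rintro ⟨k, hk⟩
      obtain ⟨h₀, hn, e⟩ := (exists_isNat_iff φ a.init).2 ⟨k.comp a.step, hk⟩
      have e2 : (chainOfHom A φ n).2.comp h₀ = k.comp a.step :=
        FracN.hom_ext a.init (e.trans hk.symm)
      have hu : h₀ a.last ∈ {x | IsUnit ((chainOfHom A φ n).2 x)} := by
        have := RingHom.congr_fun e2 a.last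
        change IsUnit (((chainOfHom A φ n).2.comp h₀) a.last)
        rw [this]
        exact (Loc.isUnit_map a.init.ring {a.last} rfl).map k
      let s := (chainOfHom A φ (n + 1)).1
      let h : a.ring →+* s.ring := Loc.lift (s.step.comp h₀) (by
        rintro x rfl
        exact Loc.isUnit_map s.init.ring s.last hu)
      have hs : h.comp a.step = s.step.comp h₀ := Loc.lift_comp _ _
      refine ⟨h, ⟨h₀, hn, hu, hs⟩, ?_⟩
      have hl : (chainOfHom A φ (n + 1)).2.comp s.step = (chainOfHom A φ n).2 :=
        chainOfHom_comp_step A φ n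
      calc ((chainOfHom A φ (n + 1)).2.comp h).comp a.map
          = ((chainOfHom A φ (n + 1)).2.comp (h.comp a.step)).comp a.init.map := rfl
        _ = (((chainOfHom A φ (n + 1)).2.comp s.step).comp h₀).comp a.init.map := by rw [hs]; rfl
        _ = φ := by rw [hl]; exact e

theorem IsNat.comp_map {A : RingCat.{u}} {B : Type u} [Ring B] (φ : A →+* B) :
    ∀ {n : ℕ} {a : FracN A n} {h}, IsNat a (chainOfHom A φ n).1 h →
      ((chainOfHom A φ n).2.comp h).comp a.map = φ
  | 0, a, h, e => by
    change h = RingHom.id A at e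
    subst e; rfl
  | n + 1, a, h, ⟨h₀, hn, _, hs⟩ => by
    have hl := chainOfHom_comp_step A φ n
    calc ((chainOfHom A φ (n + 1)).2.comp h).comp a.map
          = ((chainOfHom A φ (n + 1)).2.comp (h.comp a.step)).comp a.init.map := rfl
        _ = (((chainOfHom A φ (n + 1)).2.comp (chainOfHom A φ (n + 1)).1.step).comp h₀).comp
              a.init.map := by rw [hs]; rfl
        _ = φ := by rw [hl]; exact IsNat.comp_map φ hn

namespace Fraction

variable {A : RingCat.{u}}

theorem hom_ext (a : Fraction A) {B : Type u} [Ring B] {f g : a.ring →+* B}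
    (h : f.comp a.map = g.comp a.map) : f = g := FracN.hom_ext a.2 h

/-- The system coming from `φ` lies in `D(𝐚)` if and only if `φ` factors through `A_𝐚`. -/
theorem ofHom_mem_D {B : RingCat.{u}} [Nontrivial B] (φ : A →+* B) (a : Fraction A) :
    FullSpec.ofHom φ ∈ a.D ↔ ∃ k : a.ring →+* B, k.comp a.map = φ :=
  ⟨fun ⟨_, hh⟩ => ⟨_, IsNat.comp_map φ hh⟩,
    fun hk => let ⟨h, hn, _⟩ := (exists_isNat_iff φ a.2).2 hk; ⟨h, hn⟩⟩

theorem exists_eq_ofHom (S : FullSpec A) : ∃ (B : RingCat.{u}) (_ : Nontrivial B) (φ : A →+* B),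
    S = FullSpec.ofHom φ := by
  obtain ⟨s, B, hB, φ, h⟩ := S
  exact ⟨B, hB, φ, Subtype.ext (funext h)⟩

theorem isOpen_D (a : Fraction A) : IsOpen a.D :=
  TopologicalSpace.isOpen_generateFrom_of_mem ⟨a, rfl⟩

theorem D_subset_of_hom {a b : Fraction A} (h : a.ring →+* b.ring) (hh : h.comp a.map = b.map) :
    b.D ⊆ a.D := by
  intro S hS
  obtain ⟨B, hB, φ, rfl⟩ := exists_eq_ofHom S
  obtain ⟨k, hk⟩ := (ofHom_mem_D φ b).1 hS
  exact (ofHom_mem_D φ a).2 ⟨k.comp h, by rw [RingHom.comp_assoc, hh, hk]⟩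

/-- If `A_𝐚 ≠ 0`, then `D(𝐚)` has a center: a point all of whose open neighbourhoods
contain `D(𝐚)`. -/
theorem exists_center (a : Fraction A) [Nontrivial a.ring] :
    ∃ c ∈ a.D, ∀ U : Set (FullSpec A), IsOpen U → c ∈ U → a.D ⊆ U := by
  refine ⟨FullSpec.ofHom a.map, (ofHom_mem_D _ _).2 ⟨RingHom.id _, rfl⟩, fun U hU => ?_⟩
  induction hU with
  | basic s hs =>
    obtain ⟨b, rfl⟩ := hs
    intro hc
    obtain ⟨k, hk⟩ := (ofHom_mem_D _ _).1 hc
    exact D_subset_of_hom k hk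
  | univ => exact fun _ => Set.subset_univ _
  | inter s t _ _ h1 h2 => exact fun hc => Set.subset_inter (h1 hc.1) (h2 hc.2)
  | sUnion K _ h =>
    rintro ⟨s, hs, hc⟩
    exact (h s hs hc).trans (Set.subset_sUnion_of_mem hs)

/-- For fractions `𝐚, 𝐛` one has `D(𝐛) ⊆ D(𝐚)` if and only if there is a (necessarily unique, by
`hom_ext`) ring homomorphism `A_𝐚 → A_𝐛` under `A`. -/
theorem D_subset_iff (a b : Fraction A) :
    b.D ⊆ a.D ↔ ∃ h : a.ring →+* b.ring, h.comp a.map = b.map := by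
  refine ⟨fun hab => ?_, fun ⟨h, hh⟩ => D_subset_of_hom h hh⟩
  rcases subsingleton_or_nontrivial b.ring with hb | hb
  · exact ⟨{ toFun := fun _ => 0
             map_one' := Subsingleton.elim _ _
             map_mul' := fun _ _ => Subsingleton.elim _ _
             map_zero' := rfl
             map_add' := fun _ _ => Subsingleton.elim _ _ }, RingHom.ext fun _ =>
      Subsingleton.elim _ _⟩
  · exact (ofHom_mem_D b.map a).1 (hab ((ofHom_mem_D _ _).2 ⟨RingHom.id _, rfl⟩))

theorem exists_D_subset (a : Fraction A) [Nontrivial a.ring] {ι : Type*}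
    (U : ι → Opens (FullSpec A)) (h : a.D ⊆ (iSup U : Opens (FullSpec A))) :
    ∃ i, a.D ⊆ U i := by
  obtain ⟨c, hc, hcen⟩ := a.exists_center
  obtain ⟨i, hi⟩ := Opens.mem_iSup.1 (h hc)
  exact ⟨i, hcen _ (U i).2 hi⟩

end Fraction

/-! ### The structure sheaf -/

/-- `𝒪_A(U) = lim_{D(𝐚) ⊆ U} A_𝐚`: families `(s_𝐚)` indexed by the fractions with `D(𝐚) ⊆ U`,
compatible with the natural homomorphisms `A_𝐚 → A_𝐛` for `D(𝐛) ⊆ D(𝐚)`. -/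
def sections (A : RingCat.{u}) (U : Opens (FullSpec A)) :
    Subring (∀ a : {a : Fraction A // a.D ⊆ U}, a.1.ring) where
  carrier := {s | ∀ (a b : {a : Fraction A // a.D ⊆ U}) (h : a.1.ring →+* b.1.ring),
    h.comp a.1.map = b.1.map → h (s a) = s b}
  mul_mem' hs ht a b h hh := by simp [hs a b h hh, ht a b h hh]
  one_mem' a b h hh := by simp
  add_mem' hs ht a b h hh := by simp [hs a b h hh, ht a b h hh]
  zero_mem' a b h hh := by simp
  neg_mem' hs a b h hh := by simp [hs a b h hh]

/-- Restriction of sections. -/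
def sectionsRes (A : RingCat.{u}) {U V : Opens (FullSpec A)} (h : V ≤ U) :
    sections A U →+* sections A V where
  toFun s := ⟨fun a => s.1 ⟨a.1, a.2.trans h⟩, fun a b k hk =>
    s.2 ⟨a.1, a.2.trans h⟩ ⟨b.1, b.2.trans h⟩ k hk⟩
  map_one' := rfl
  map_mul' _ _ := rfl
  map_zero' := rfl
  map_add' _ _ := rfl

/-- The structure presheaf `𝒪_A` on `F(A)`. -/
def structurePresheaf (A : RingCat.{u}) :
    TopCat.Presheaf RingCat.{u} (TopCat.of (FullSpec A)) where
  obj U := RingCat.of (sections A U.unop)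
  map i := RingCat.ofHom (sectionsRes A i.unop.le)
  map_id _ := rfl
  map_comp _ _ := rfl

theorem structurePresheaf_isSheaf (A : RingCat.{u}) : (structurePresheaf A).IsSheaf := by
  rw [TopCat.Presheaf.isSheaf_iff_isSheafUniqueGluing]
  intro ι U sf' hsf'
  let sf : ∀ i, sections A (U i) := sf'
  have hsf : ∀ i j, sectionsRes A (inf_le_left : U i ⊓ U j ≤ U i) (sf i) =
      sectionsRes A (inf_le_right : U i ⊓ U j ≤ U j) (sf j) := hsf'
  have hc : ∀ (i j : ι) (a : Fraction A) (hi : a.D ⊆ U i) (hj : a.D ⊆ U j),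
      (sf i).1 ⟨a, hi⟩ = (sf j).1 ⟨a, hj⟩ := by
    intro i j a hi hj
    have := congrArg (fun t : sections A (U i ⊓ U j) => t.1 ⟨a, Set.subset_inter hi hj⟩) (hsf i j)
    exact this
  classical
  let s : sections A (iSup U) := ⟨fun a =>
      if h : ∃ i, a.1.D ⊆ U i then (sf h.choose).1 ⟨a.1, h.choose_spec⟩ else 0, by
    intro a b k hk
    rcases subsingleton_or_nontrivial a.1.ring with ha | ha
    · have : Subsingleton b.1.ring := by
        refine subsingleton_of_zero_eq_one ?_
        rw [← map_one k, ← map_zero k, Subsingleton.elim (0 : a.1.ring) 1]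
      exact Subsingleton.elim _ _
    · have h1 : ∃ i, a.1.D ⊆ U i := a.1.exists_D_subset U a.2
      have hb := Fraction.D_subset_of_hom k hk
      have h2 : ∃ i, b.1.D ⊆ U i := ⟨_, hb.trans h1.choose_spec⟩
      simp only [dif_pos h1, dif_pos h2]
      rw [hc h2.choose h1.choose b.1 h2.choose_spec (hb.trans h1.choose_spec)]
      exact (sf h1.choose).2 ⟨a.1, h1.choose_spec⟩ ⟨b.1, _⟩ k hk⟩
  refine ⟨s, fun i => ?_, fun t ht => ?_⟩
  · refine Subtype.ext (funext fun a => ?_)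
    have h1 : ∃ i, a.1.D ⊆ U i := ⟨i, a.2⟩
    change s.1 ⟨a.1, _⟩ = _
    simp only [s, dif_pos h1]
    exact hc _ _ _ _ _
  · refine Subtype.ext (funext fun a => ?_)
    rcases subsingleton_or_nontrivial a.1.ring with ha | ha
    · exact Subsingleton.elim (α := a.1.ring) _ _
    · have h1 : ∃ i, a.1.D ⊆ U i := a.1.exists_D_subset U a.2
      have := congrArg (fun t : sections A (U h1.choose) => t.1 ⟨a.1, h1.choose_spec⟩)
        (ht h1.choose)
      simp only [s, dif_pos h1]
      exact this

/-- The ringed space `(F(A), 𝒪_A)`. -/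
def FSpec (A : RingCat.{u}) : SheafedSpace RingCat.{u} where
  carrier := TopCat.of (FullSpec A)
  presheaf := structurePresheaf A
  IsSheaf := structurePresheaf_isSheaf A

/-- An F-scheme: a ringed space in which every point has an open neighbourhood isomorphic, as a
ringed space, to `F(A)` for some ring `A`. -/
def IsFScheme (X : SheafedSpace RingCat.{u}) : Prop :=
  ∀ x : X, ∃ U : Opens X, x ∈ U ∧ ∃ A : RingCat.{u},
    Nonempty (X.restrict U.isOpenEmbedding ≅ FSpec A)

/-! ### Sheaves of two-sided ideals -/

/-- A sheaf of two-sided ideals on a ringed space: a subsheaf of `𝒪_X` whose sections over each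
open set form a two-sided ideal. -/
structure IdealSheaf (X : SheafedSpace RingCat.{u}) where
  ideal : ∀ U : Opens X, TwoSidedIdeal (X.presheaf.obj (op U))
  map_mem : ∀ {U V : Opens X} (i : V ⟶ U) (s : X.presheaf.obj (op U)),
    s ∈ ideal U → X.presheaf.map i.op s ∈ ideal V
  locally_mem : ∀ (U : Opens X) (s : X.presheaf.obj (op U)),
    (∀ x ∈ U, ∃ (V : Opens X) (i : V ⟶ U), x ∈ V ∧ X.presheaf.map i.op s ∈ ideal V) →
      s ∈ ideal U

theorem germ_inf_left {X : SheafedSpace RingCat.{u}} {U V : Opens X} {x : X} (hU : x ∈ U)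
    (hV : x ∈ V) (s : X.presheaf.obj (op U)) :
    X.presheaf.germ (U ⊓ V) x ⟨hU, hV⟩ (X.presheaf.map (homOfLE inf_le_left).op s) =
      X.presheaf.germ U x hU s :=
  TopCat.Presheaf.germ_res_apply X.presheaf (homOfLE inf_le_left : U ⊓ V ⟶ U) x ⟨hU, hV⟩ s

theorem germ_inf_right {X : SheafedSpace RingCat.{u}} {U V : Opens X} {x : X} (hU : x ∈ U)
    (hV : x ∈ V) (s : X.presheaf.obj (op V)) :
    X.presheaf.germ (U ⊓ V) x ⟨hU, hV⟩ (X.presheaf.map (homOfLE inf_le_right).op s) =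
      X.presheaf.germ V x hV s :=
  TopCat.Presheaf.germ_res_apply X.presheaf (homOfLE inf_le_right : U ⊓ V ⟶ V) x ⟨hU, hV⟩ s

namespace IdealSheaf

variable {X : SheafedSpace RingCat.{u}} (I : IdealSheaf X)

/-- The stalk `ℐ_x ⊆ 𝒪_{X,x}`: the two-sided ideal of germs of sections of `ℐ`. -/
def stalk (x : X) : TwoSidedIdeal (X.presheaf.stalk x) :=
  TwoSidedIdeal.mk'
    {g | ∃ (U : Opens X) (hx : x ∈ U) (s : X.presheaf.obj (op U)),
      s ∈ I.ideal U ∧ X.presheaf.germ U x hx s = g}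
    ⟨⊤, trivial, 0, TwoSidedIdeal.zero_mem _, map_zero _⟩
    (by
      rintro _ _ ⟨U, hU, s, hs, rfl⟩ ⟨V, hV, t, ht, rfl⟩
      refine ⟨U ⊓ V, ⟨hU, hV⟩, X.presheaf.map (homOfLE inf_le_left).op s +
        X.presheaf.map (homOfLE inf_le_right).op t,
        TwoSidedIdeal.add_mem _ (I.map_mem _ _ hs) (I.map_mem _ _ ht), ?_⟩
      rw [map_add, germ_inf_left hU hV, germ_inf_right hU hV])
    (by
      rintro _ ⟨U, hU, s, hs, rfl⟩
      exact ⟨U, hU, -s, TwoSidedIdeal.neg_mem _ hs, map_neg _ _⟩)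
    (by
      rintro g _ ⟨V, hV, t, ht, rfl⟩
      obtain ⟨U, hU, s, rfl⟩ := TopCat.Presheaf.exists_germ_eq _ g
      refine ⟨U ⊓ V, ⟨hU, hV⟩, X.presheaf.map (homOfLE inf_le_left).op s *
        X.presheaf.map (homOfLE inf_le_right).op t,
        TwoSidedIdeal.mul_mem_left _ _ _ (I.map_mem _ _ ht), ?_⟩
      rw [map_mul, germ_inf_left hU hV, germ_inf_right hU hV])
    (by
      rintro _ g ⟨V, hV, t, ht, rfl⟩
      obtain ⟨U, hU, s, rfl⟩ := TopCat.Presheaf.exists_germ_eq _ g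
      refine ⟨U ⊓ V, ⟨hU, hV⟩, X.presheaf.map (homOfLE inf_le_right).op t *
        X.presheaf.map (homOfLE inf_le_left).op s,
        TwoSidedIdeal.mul_mem_right _ _ _ (I.map_mem _ _ ht), ?_⟩
      rw [map_mul, germ_inf_right hU hV, germ_inf_left hU hV])

/-- `Z(ℐ) = {x ∈ X | ℐ_x ⊆ J(𝒪_{X,x})}`. -/
def zeroLocus : Set X :=
  {x | ∀ g ∈ I.stalk x, g ∈ Ring.jacobson (X.presheaf.stalk x)}

/-- The stalk `𝒪_{X,x} / ℐ_x` of the quotient sheaf `𝒪_X / ℐ`. -/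
abbrev quotStalk (x : X) : Type u := (I.stalk x).ringCon.Quotient

/-- The class of the germ at `x` of a section of `𝒪_X` in `𝒪_{X,x} / ℐ_x`. -/
def quotGerm {U : Opens X} (s : X.presheaf.obj (op U)) (x : X) (hx : x ∈ U) : I.quotStalk x :=
  (I.stalk x).ringCon.mk' (X.presheaf.germ U x hx s)

/-- Sections over an open `V ⊆ Z(ℐ)` of the restriction to `Z(ℐ)` (the inverse image) of the sheaf
`𝒪_X / ℐ`: functions assigning to `z ∈ V` an element of the stalk `𝒪_{X,z} / ℐ_z`, which near each
point of `V` are given by a section of `𝒪_X` over an open subset of `X`. -/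
def quotSections (V : Opens I.zeroLocus) : Subring (∀ z : V, I.quotStalk z.1.1) where
  carrier := {t | ∀ z : V, ∃ (U : Opens X) (_ : z.1.1 ∈ U) (s : X.presheaf.obj (op U)),
    ∀ (w : V) (hw : w.1.1 ∈ U), t w = I.quotGerm s w.1.1 hw}
  mul_mem' := by
    intro t t' ht ht' z
    obtain ⟨U, hz, s, hs⟩ := ht z
    obtain ⟨U', hz', s', hs'⟩ := ht' z
    refine ⟨U ⊓ U', ⟨hz, hz'⟩, X.presheaf.map (homOfLE inf_le_left).op s *
        X.presheaf.map (homOfLE inf_le_right).op s', fun w hw => ?_⟩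
    rw [Pi.mul_apply, hs w hw.1, hs' w hw.2]
    simp only [quotGerm]
    rw [map_mul, map_mul, germ_inf_left hw.1 hw.2, germ_inf_right hw.1 hw.2]
  one_mem' := fun z => ⟨⊤, trivial, 1, fun w hw => by
    simp only [quotGerm]; rw [map_one, map_one]; rfl⟩
  add_mem' := by
    intro t t' ht ht' z
    obtain ⟨U, hz, s, hs⟩ := ht z
    obtain ⟨U', hz', s', hs'⟩ := ht' z
    refine ⟨U ⊓ U', ⟨hz, hz'⟩, X.presheaf.map (homOfLE inf_le_left).op s +
        X.presheaf.map (homOfLE inf_le_right).op s', fun w hw => ?_⟩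
    rw [Pi.add_apply, hs w hw.1, hs' w hw.2]
    simp only [quotGerm]
    rw [map_add, map_add, germ_inf_left hw.1 hw.2, germ_inf_right hw.1 hw.2]
  zero_mem' := fun z => ⟨⊤, trivial, 0, fun w hw => by
    simp only [quotGerm]; rw [map_zero, map_zero]; rfl⟩
  neg_mem' := by
    intro t ht z
    obtain ⟨U, hz, s, hs⟩ := ht z
    refine ⟨U, hz, -s, fun w hw => ?_⟩
    rw [Pi.neg_apply, hs w hw]
    simp only [quotGerm]
    rw [map_neg, map_neg]

/-- The presheaf of rings `V ↦ (𝒪_X / ℐ)|_{Z(ℐ)}(V)`. -/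
def quotPresheaf : TopCat.Presheaf RingCat.{u} (TopCat.of I.zeroLocus) where
  obj V := RingCat.of (I.quotSections V.unop)
  map i := RingCat.ofHom
    { toFun := fun t => ⟨fun z => t.1 ⟨z.1, i.unop.le z.2⟩, fun z =>
        let ⟨U, hz, s, hs⟩ := t.2 ⟨z.1, i.unop.le z.2⟩
        ⟨U, hz, s, fun w hw => hs ⟨w.1, i.unop.le w.2⟩ hw⟩⟩
      map_one' := rfl
      map_mul' := fun _ _ => rfl
      map_zero' := rfl
      map_add' := fun _ _ => rfl }
  map_id _ := rfl
  map_comp _ _ := rfl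

theorem quotPresheaf_isSheaf : I.quotPresheaf.IsSheaf := by
  rw [TopCat.Presheaf.isSheaf_iff_isSheafUniqueGluing]
  intro ι V sf hsf
  have hc : ∀ (i j : ι) (z : I.zeroLocus) (hi : z ∈ V i) (hj : z ∈ V j),
      (sf i : I.quotSections (V i)).1 ⟨z, hi⟩ = (sf j : I.quotSections (V j)).1 ⟨z, hj⟩ := by
    intro i j z hi hj
    exact congrArg (fun t : I.quotSections (V i ⊓ V j) => t.1 ⟨z, ⟨hi, hj⟩⟩) (hsf i j)
  have hex : ∀ z : (iSup V : Opens I.zeroLocus), ∃ i, z.1 ∈ V i := fun z => Opens.mem_iSup.1 z.2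
  choose k hk using hex
  let t : I.quotSections (iSup V) :=
    ⟨fun z => (sf (k z) : I.quotSections (V (k z))).1 ⟨z.1, hk z⟩, by
      intro z
      obtain ⟨U, hz, s, hs⟩ := (sf (k z) : I.quotSections (V (k z))).2 ⟨z.1, hk z⟩
      obtain ⟨W, hW, hWV⟩ := isOpen_induced_iff.1 (V (k z)).2
      have hzW : z.1 ∈ (Subtype.val ⁻¹' W : Set I.zeroLocus) := by rw [hWV]; exact hk z
      refine ⟨U ⊓ ⟨W, hW⟩, ⟨hz, hzW⟩, X.presheaf.map (homOfLE inf_le_left).op s, fun w hw => ?_⟩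
      have hwV : w.1 ∈ V (k z) := by
        have : w.1 ∈ (Subtype.val ⁻¹' W : Set I.zeroLocus) := hw.2
        rw [hWV] at this
        exact this
      refine (hc _ (k z) w.1 (hk w) hwV).trans ((hs ⟨w.1, hwV⟩ hw.1).trans ?_)
      simp only [quotGerm]
      rw [germ_inf_left hw.1 hw.2]⟩
  refine ⟨t, fun i => ?_, fun t' ht' => ?_⟩
  · exact Subtype.ext (funext fun z => hc _ _ _ _ _)
  · refine Subtype.ext (funext fun z => ?_)
    exact congrArg (fun t : I.quotSections (V (k z)) => t.1 ⟨z.1, hk z⟩) (ht' (k z))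

/-- The ringed space `(Z(ℐ), 𝒪_X / ℐ)`. -/
def closedSub : SheafedSpace RingCat.{u} where
  carrier := TopCat.of I.zeroLocus
  presheaf := I.quotPresheaf
  IsSheaf := I.quotPresheaf_isSheaf

end IdealSheaf

/-! ### The sheaf of bimodules attached to a bimodule, quasi-coherence -/

section Bimodule

variable {A : Type u} [Ring A] (N : Type u) [AddCommGroup N] [Module A N] [Module Aᵐᵒᵖ N]

/-- The relations `b φ(a) ⊗ n ⊗ c = b ⊗ a n ⊗ c` and `b ⊗ n a ⊗ c = b ⊗ n ⊗ φ(a) c` in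
`B ⊗_ℤ N ⊗_ℤ B`. -/
def biextRel {B : Type u} [Ring B] (φ : A →+* B) : AddSubgroup (B ⊗[ℤ] (N ⊗[ℤ] B)) :=
  AddSubgroup.closure
    ({x | ∃ (b : B) (a : A) (n : N) (c : B),
        x = (b * φ a) ⊗ₜ[ℤ] (n ⊗ₜ[ℤ] c) - b ⊗ₜ[ℤ] ((a • n) ⊗ₜ[ℤ] c)} ∪
      {x | ∃ (b : B) (n : N) (a : A) (c : B),
        x = b ⊗ₜ[ℤ] ((MulOpposite.op a • n) ⊗ₜ[ℤ] c) - b ⊗ₜ[ℤ] (n ⊗ₜ[ℤ] (φ a * c))})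

/-- `B ⊗_A N ⊗_A B` for an `A`-bimodule `N` and a ring homomorphism `φ : A → B`. -/
def Biext {B : Type u} [Ring B] (φ : A →+* B) : Type u :=
  (B ⊗[ℤ] (N ⊗[ℤ] B)) ⧸ biextRel N φ

instance {B : Type u} [Ring B] (φ : A →+* B) : AddCommGroup (Biext N φ) :=
  inferInstanceAs (AddCommGroup ((B ⊗[ℤ] (N ⊗[ℤ] B)) ⧸ biextRel N φ))

/-- The map `b ⊗ n ⊗ c ↦ f(b) ⊗ n ⊗ g(c)`. -/
def tensorMap {B C : Type u} [Ring B] [Ring C] (f g : B →+ C) :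
    B ⊗[ℤ] (N ⊗[ℤ] B) →+ C ⊗[ℤ] (N ⊗[ℤ] C) :=
  (TensorProduct.map f.toIntLinearMap
    (TensorProduct.map LinearMap.id g.toIntLinearMap)).toAddMonoidHom

theorem tensorMap_tmul {B C : Type u} [Ring B] [Ring C] (f g : B →+ C) (b : B) (n : N) (c : B) :
    tensorMap N f g (b ⊗ₜ[ℤ] (n ⊗ₜ[ℤ] c)) = f b ⊗ₜ[ℤ] (n ⊗ₜ[ℤ] g c) := rfl

/-- Left multiplication by `r ∈ B` on `B ⊗_A N ⊗_A B`. -/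
def biextLeft {B : Type u} [Ring B] (φ : A →+* B) (r : B) : Biext N φ →+ Biext N φ :=
  QuotientAddGroup.map (biextRel N φ) (biextRel N φ)
    (tensorMap N (AddMonoidHom.mulLeft r) (AddMonoidHom.id B)) (by
      rw [biextRel, AddSubgroup.closure_le]
      rintro _ (⟨b, a, n, c, rfl⟩ | ⟨b, n, a, c, rfl⟩)
      · refine AddSubgroup.subset_closure (Or.inl ⟨r * b, a, n, c, ?_⟩)
        rw [map_sub, tensorMap_tmul, tensorMap_tmul]
        simp [mul_assoc]
      · refine AddSubgroup.subset_closure (Or.inr ⟨r * b, n, a, c, ?_⟩)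
        rw [map_sub, tensorMap_tmul, tensorMap_tmul]
        simp)

/-- Right multiplication by `r ∈ B` on `B ⊗_A N ⊗_A B`. -/
def biextRight {B : Type u} [Ring B] (φ : A →+* B) (r : B) : Biext N φ →+ Biext N φ :=
  QuotientAddGroup.map (biextRel N φ) (biextRel N φ)
    (tensorMap N (AddMonoidHom.id B) (AddMonoidHom.mulRight r)) (by
      rw [biextRel, AddSubgroup.closure_le]
      rintro _ (⟨b, a, n, c, rfl⟩ | ⟨b, n, a, c, rfl⟩)
      · refine AddSubgroup.subset_closure (Or.inl ⟨b, a, n, c * r, ?_⟩)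
        rw [map_sub, tensorMap_tmul, tensorMap_tmul]
        simp
      · refine AddSubgroup.subset_closure (Or.inr ⟨b, n, a, c * r, ?_⟩)
        rw [map_sub, tensorMap_tmul, tensorMap_tmul]
        simp [mul_assoc])

/-- The map `B ⊗_A N ⊗_A B → C ⊗_A N ⊗_A C` induced by a homomorphism `h : B → C` under `A`. -/
def biextMap {B C : Type u} [Ring B] [Ring C] (φ : A →+* B) (ψ : A →+* C) (h : B →+* C)
    (hh : h.comp φ = ψ) : Biext N φ →+ Biext N ψ :=
  QuotientAddGroup.map (biextRel N φ) (biextRel N ψ) (tensorMap N h.toAddMonoidHom h.toAddMonoidHom)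
    (by
      subst hh
      rw [biextRel, AddSubgroup.closure_le]
      rintro _ (⟨b, a, n, c, rfl⟩ | ⟨b, n, a, c, rfl⟩)
      · refine AddSubgroup.subset_closure (Or.inl ⟨h b, a, n, h c, ?_⟩)
        rw [map_sub, tensorMap_tmul, tensorMap_tmul]
        simp
      · refine AddSubgroup.subset_closure (Or.inr ⟨h b, n, a, h c, ?_⟩)
        rw [map_sub, tensorMap_tmul, tensorMap_tmul]
        simp)

/-- The pure tensor `b ⊗ n ⊗ c` in `B ⊗_A N ⊗_A B`. -/
def biextMk {B : Type u} [Ring B] (φ : A →+* B) (b : B) (n : N) (c : B) : Biext N φ :=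
  QuotientAddGroup.mk' (biextRel N φ) (b ⊗ₜ[ℤ] (n ⊗ₜ[ℤ] c))

theorem biext_hom_ext {B : Type u} [Ring B] (φ : A →+* B) {M : Type u} [AddCommGroup M]
    {f g : Biext N φ →+ M} (h : ∀ b n c, f (biextMk N φ b n c) = g (biextMk N φ b n c)) :
    f = g := by
  refine QuotientAddGroup.addMonoidHom_ext (biextRel N φ) ?_
  ext x
  induction x using TensorProduct.induction_on with
  | zero => simp
  | add x y hx hy => rw [map_add, hx, hy, map_add]
  | tmul b y =>
    induction y using TensorProduct.induction_on with
    | zero => simp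
    | add x y hx hy => rw [TensorProduct.tmul_add, map_add, hx, hy, map_add]
    | tmul n c => exact h b n c

theorem biextMap_left {B C : Type u} [Ring B] [Ring C] (φ : A →+* B) (ψ : A →+* C) (h : B →+* C)
    (hh : h.comp φ = ψ) (r : B) (x : Biext N φ) :
    biextMap N φ ψ h hh (biextLeft N φ r x) = biextLeft N ψ (h r) (biextMap N φ ψ h hh x) := by
  refine DFunLike.congr_fun (f := (biextMap N φ ψ h hh).comp (biextLeft N φ r))
    (g := (biextLeft N ψ (h r)).comp (biextMap N φ ψ h hh)) (biext_hom_ext N φ fun b n c => ?_) x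
  change biextMk N ψ (h (r * b)) n (h c) = biextMk N ψ (h r * h b) n (h c)
  rw [map_mul]

theorem biextMap_right {B C : Type u} [Ring B] [Ring C] (φ : A →+* B) (ψ : A →+* C) (h : B →+* C)
    (hh : h.comp φ = ψ) (r : B) (x : Biext N φ) :
    biextMap N φ ψ h hh (biextRight N φ r x) = biextRight N ψ (h r) (biextMap N φ ψ h hh x) := by
  refine DFunLike.congr_fun (f := (biextMap N φ ψ h hh).comp (biextRight N φ r))
    (g := (biextRight N ψ (h r)).comp (biextMap N φ ψ h hh)) (biext_hom_ext N φ fun b n c => ?_) x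
  change biextMk N ψ (h b) n (h (c * r)) = biextMk N ψ (h b) n (h c * h r)
  rw [map_mul]

end Bimodule

section Hat

variable {A : RingCat.{u}} (N : Type u) [AddCommGroup N] [Module A N] [Module Aᵐᵒᵖ N]

/-- `N̂(U) = lim_{D(𝐚) ⊆ U} A_𝐚 ⊗_A N ⊗_A A_𝐚`, for an `A`-bimodule `N`. -/
def hatSections (U : Opens (FullSpec A)) :
    AddSubgroup (∀ a : {a : Fraction A // a.D ⊆ U}, Biext N a.1.map) where
  carrier := {s | ∀ (a b : {a : Fraction A // a.D ⊆ U}) (h : a.1.ring →+* b.1.ring)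
    (hh : h.comp a.1.map = b.1.map), biextMap N a.1.map b.1.map h hh (s a) = s b}
  add_mem' hs ht a b h hh := by simp [hs a b h hh, ht a b h hh]
  zero_mem' a b h hh := by simp
  neg_mem' hs a b h hh := by simp [hs a b h hh]

/-- Restriction of sections of `N̂`. -/
def hatRes {U V : Opens (FullSpec A)} (h : V ≤ U) (s : hatSections N U) : hatSections N V :=
  ⟨fun a => s.1 ⟨a.1, a.2.trans h⟩, fun a b k hk =>
    s.2 ⟨a.1, a.2.trans h⟩ ⟨b.1, b.2.trans h⟩ k hk⟩

/-- The left `𝒪_A(U)`-module structure of `N̂(U)`. -/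
def hatLeft {U : Opens (FullSpec A)} (r : sections A U) (s : hatSections N U) : hatSections N U :=
  ⟨fun a => biextLeft N a.1.map (r.1 a) (s.1 a), fun a b h hh => by
    rw [biextMap_left, s.2 a b h hh, r.2 a b h hh]⟩

/-- The right `𝒪_A(U)`-module structure of `N̂(U)`. -/
def hatRight {U : Opens (FullSpec A)} (s : hatSections N U) (r : sections A U) : hatSections N U :=
  ⟨fun a => biextRight N a.1.map (r.1 a) (s.1 a), fun a b h hh => by
    rw [biextMap_right, s.2 a b h hh, r.2 a b h hh]⟩

end Hat

namespace IdealSheaf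

variable {X : SheafedSpace RingCat.{u}}

/-- For an isomorphism `e : X|_U ≅ F(A)` and an open `V ⊆ F(A)`, the corresponding open subset
`e⁻¹(V) ⊆ U` of `X`. -/
def chartOpen {U : Opens X} {A : RingCat.{u}} (e : X.restrict U.isOpenEmbedding ≅ FSpec A)
    (V : Opens (FullSpec A)) : Opens X :=
  U.isOpenEmbedding.isOpenMap.functor.obj ((Opens.map e.hom.hom.base).obj V)

/-- The ring homomorphism `e^♯ : 𝒪_A(V) → 𝒪_X(e⁻¹(V))`. -/
def chartRing {U : Opens X} {A : RingCat.{u}} (e : X.restrict U.isOpenEmbedding ≅ FSpec A)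
    (V : Opens (FullSpec A)) : sections A V →+* X.presheaf.obj (op (chartOpen e V)) :=
  (e.hom.hom.c.app (op V)).hom

/-- An isomorphism `N̂ ≅ ℐ|_U` of sheaves of bimodules over the isomorphism `e : X|_U ≅ F(A)`. -/
structure HatIso (I : IdealSheaf X) {U : Opens X} {A : RingCat.{u}}
    (e : X.restrict U.isOpenEmbedding ≅ FSpec A)
    (N : Type u) [AddCommGroup N] [Module A N] [Module Aᵐᵒᵖ N] where
  /-- The isomorphism on sections over `V`. -/
  equiv : ∀ V : Opens (FullSpec A), hatSections N V ≃+ I.ideal (chartOpen e V)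
  res : ∀ {V W : Opens (FullSpec A)} (h : W ≤ V) (i : chartOpen e W ⟶ chartOpen e V)
    (s : hatSections N V),
    (equiv W (hatRes N h s) : X.presheaf.obj (op (chartOpen e W))) =
      X.presheaf.map i.op (equiv V s : X.presheaf.obj (op (chartOpen e V)))
  left : ∀ (V : Opens (FullSpec A)) (r : sections A V) (s : hatSections N V),
    (equiv V (hatLeft N r s) : X.presheaf.obj (op (chartOpen e V))) =
      chartRing e V r * (equiv V s : X.presheaf.obj (op (chartOpen e V)))
  right : ∀ (V : Opens (FullSpec A)) (s : hatSections N V) (r : sections A V),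
    (equiv V (hatRight N s r) : X.presheaf.obj (op (chartOpen e V))) =
      (equiv V s : X.presheaf.obj (op (chartOpen e V))) * chartRing e V r

/-- `ℐ` is quasi-coherent: `X` is covered by open subsets `U ≅ F(A)` such that `ℐ|_U ≅ N̂` as
sheaves of bimodules, for some `A`-bimodule `N`. -/
def IsQuasiCoherent (I : IdealSheaf X) : Prop :=
  ∀ x : X, ∃ U : Opens X, x ∈ U ∧ ∃ (A : RingCat.{u}) (e : X.restrict U.isOpenEmbedding ≅ FSpec A)
    (N : Type u) (_ : AddCommGroup N) (_ : Module A N) (_ : Module Aᵐᵒᵖ N)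
    (_ : SMulCommClass A Aᵐᵒᵖ N), Nonempty (I.HatIso e N)

end IdealSheaf

/-! ### The affine case -/

/-- The homomorphism `A → Γ(F(A), 𝒪_A)`. -/
def toGlobal (A : RingCat.{u}) : A →+* (FSpec A).presheaf.obj (op ⊤) where
  toFun x := (⟨fun a => a.1.map x, fun _ _ _ hh => RingHom.congr_fun hh x⟩ : sections A ⊤)
  map_one' := Subtype.ext (funext fun a => map_one a.1.map)
  map_mul' x y := Subtype.ext (funext fun a => map_mul a.1.map x y)
  map_zero' := Subtype.ext (funext fun a => map_zero a.1.map)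
  map_add' x y := Subtype.ext (funext fun a => map_add a.1.map x y)

/-- The ideal `Γ(F(A), ℐ)` of `A ≅ Γ(F(A), 𝒪_A)`. -/
def IdealSheaf.globalIdeal {A : RingCat.{u}} (I : IdealSheaf (FSpec A)) : TwoSidedIdeal A :=
  (I.ideal ⊤).comap (toGlobal A)

/-- The `s ∈ 𝒪_A(U)` such that `s_𝐚` lies in the two-sided ideal of `A_𝐚` generated by `I` whenever
`D(𝐚) ⊆ U`. -/
def generatedIdeal (A : RingCat.{u}) (I : TwoSidedIdeal A) (U : Opens (FullSpec A)) :
    TwoSidedIdeal (sections A U) :=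
  TwoSidedIdeal.mk'
    {s | ∀ a : {a : Fraction A // a.D ⊆ U}, s.1 a ∈ TwoSidedIdeal.span (a.1.map '' I)}
    (fun _ => TwoSidedIdeal.zero_mem _)
    (fun hs ht a => TwoSidedIdeal.add_mem _ (hs a) (ht a))
    (fun hs a => TwoSidedIdeal.neg_mem _ (hs a))
    (fun hs a => TwoSidedIdeal.mul_mem_left _ _ _ (hs a))
    (fun hs a => TwoSidedIdeal.mul_mem_right _ _ _ (hs a))

theorem mem_generatedIdeal {A : RingCat.{u}} {I : TwoSidedIdeal A} {U : Opens (FullSpec A)}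
    {s : sections A U} : s ∈ generatedIdeal A I U ↔
      ∀ a : {a : Fraction A // a.D ⊆ U}, s.1 a ∈ TwoSidedIdeal.span (a.1.map '' I) :=
  TwoSidedIdeal.mem_mk'
    {s : sections A U | ∀ a : {a : Fraction A // a.D ⊆ U},
      s.1 a ∈ TwoSidedIdeal.span (a.1.map '' I)}
    (fun _ => TwoSidedIdeal.zero_mem _)
    (fun hs ht a => TwoSidedIdeal.add_mem _ (hs a) (ht a))
    (fun hs a => TwoSidedIdeal.neg_mem _ (hs a))
    (fun hs a => TwoSidedIdeal.mul_mem_left _ _ _ (hs a))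
    (fun hs a => TwoSidedIdeal.mul_mem_right _ _ _ (hs a)) s

/-- The sheaf of ideals on `F(A)` generated by a two-sided ideal `I` of `A`, i.e. the image of the
canonical map `Î → 𝒪_A`. -/
def idealSheafOf (A : RingCat.{u}) (I : TwoSidedIdeal A) : IdealSheaf (FSpec A) where
  ideal U := generatedIdeal A I U
  map_mem := fun i _ hs =>
    mem_generatedIdeal.2 fun a => mem_generatedIdeal.1 hs ⟨a.1, a.2.trans i.le⟩
  locally_mem := by
    intro U s h
    refine mem_generatedIdeal.2 fun a => ?_
    rcases subsingleton_or_nontrivial a.1.ring with ha | ha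
    · have : (s : sections A U).1 a = 0 := Subsingleton.elim _ _
      rw [this]
      exact TwoSidedIdeal.zero_mem _
    · obtain ⟨c, hc, hcen⟩ := a.1.exists_center
      obtain ⟨V, i, hcV, hV⟩ := h c (a.2 hc)
      exact mem_generatedIdeal.1 hV ⟨a.1, hcen _ V.2 hcV⟩

/-- The quotient ring `A / I` by a two-sided ideal. -/
def quotRing (A : RingCat.{u}) (I : TwoSidedIdeal A) : RingCat.{u} :=
  RingCat.of I.ringCon.Quotient

end

end FSch

/-! The point of `F(A)` given by `φ : A → B` lies in `D(𝐚)` exactly when `φ` factors through `A_𝐚`,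
and the sets `D(𝐚)` containing a point determine it (`FullSpec.ext_of_mem_D`). So `F(A)` can be
handled through factorizations, without touching the sequences `(S₁, S₂, …)`.

For `π : A → C`, replacing the entries of a fraction `𝐚` by their images gives a fraction `𝐛` of `C`
such that `C_𝐛` is the pushout of `A_𝐚` (`Fraction.IsPush`). This makes `F` functorial (`FSpecMap`).
If `π` is onto, every fraction of `C` arises in this way, `A_𝐚 → C_𝐛` is onto, and its kernel is
generated by `ker π`. Hence `F(C) → F(A)` is a topological embedding, surjective on stalks, and the
kernels on stalks are the stalks of the ideal sheaf generated by `ker π`.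

The Jacobson radical enters through units. The germ of `x ∈ A_𝐚` at `S` is a unit iff `S ∈ D(𝐚,x)`,
so the stalk maps of `FSpecMap` reflect units, which forces their kernels into the radical.
Conversely, if `ℐ_S` lies in the radical, then `𝒪_S → 𝒪_S/ℐ_S` reflects units, so `A → 𝒪_S/ℐ_S`
still represents `S`; it kills `ker π`, factors through `C`, and puts `S` in the image of `F(C)`.
Thus the image is the zero locus (`range_comap_eq`), and the germwise criterion `IsOpenInClosed`
yields the isomorphism of ringed spaces.

For quasi-coherent ideals, `N̂(D(𝐚)) = A_𝐚 ⊗ N ⊗ A_𝐚` is generated as a bimodule by the global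
sections `1 ⊗ n ⊗ 1`. So on a chart the ideal sheaf is the one generated by its global sections
(`IdealSheaf.HatIso.chartRing_mem_iff`), and the affine result transfers along the open immersion of
the chart. If `X = F(A)` with `A ≠ 0`, the space has a point whose only neighbourhood is everything,
so a single chart covers it. -/

namespace FSch

noncomputable section

/-! ### Fractions and factorizations -/

section Factorization

variable {A C : RingCat.{u}}

/-- The homomorphism `φ : A → B` factors through `A_𝐚`. -/
def Fraction.Through (a : Fraction A) {B : Type u} [Ring B] (φ : A →+* B) : Prop :=
  ∃ k : a.ring →+* B, k.comp a.map = φ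

/-- The empty fraction. -/
def Fraction.nil (A : RingCat.{u}) : Fraction A := ⟨0, PUnit.unit⟩

/-- Append an element `x ∈ A_𝐚` to the fraction `𝐚`. -/
def Fraction.snoc (a : Fraction A) (x : a.ring) : Fraction A :=
  ⟨a.1 + 1, (⟨a.2, x⟩ : FracN A (a.1 + 1))⟩

/-- The localization map `A_𝐚 → A_(𝐚,x)`. -/
def Fraction.snocMap (a : Fraction A) (x : a.ring) : a.ring →+* (a.snoc x).ring :=
  Loc.map a.ring {x}

theorem Fraction.snocMap_comp_map (a : Fraction A) (x : a.ring) :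
    (a.snocMap x).comp a.map = (a.snoc x).map := rfl

theorem FracN.induction {P : Fraction A → Prop} (h0 : P (Fraction.nil A))
    (h1 : ∀ (a : Fraction A) (x : a.ring), P a → P (a.snoc x)) : ∀ (n : ℕ) (a : FracN A n), P ⟨n, a⟩
  | 0, _ => h0
  | n + 1, a => h1 ⟨n, a.init⟩ a.last (FracN.induction h0 h1 n a.init)

theorem Fraction.induction {P : Fraction A → Prop} (a : Fraction A) (h0 : P (Fraction.nil A))
    (h1 : ∀ (a : Fraction A) (x : a.ring), P a → P (a.snoc x)) : P a :=
  FracN.induction h0 h1 a.1 a.2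

theorem Fraction.isUnit_snocMap (a : Fraction A) (x : a.ring) : IsUnit (a.snocMap x x) :=
  Loc.isUnit_map a.ring {x} rfl

theorem Fraction.exists_snoc_lift (a : Fraction A) (x : a.ring) {B : Type u} [Ring B]
    (k : a.ring →+* B) (h : IsUnit (k x)) :
    ∃ k' : (a.snoc x).ring →+* B, k'.comp (a.snocMap x) = k :=
  ⟨Loc.lift k fun s hs => by rw [Set.mem_singleton_iff.1 hs]; exact h, Loc.lift_comp _ _⟩

theorem Fraction.through_nil {B : Type u} [Ring B] (φ : A →+* B) : (Fraction.nil A).Through φ :=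
  ⟨φ, rfl⟩

/-- A map out of `A_𝐚` is determined by its restriction to `A`, so any factorization through the
last localization must extend the given `k`. -/
theorem Fraction.through_snoc (a : Fraction A) (x : a.ring) {B : Type u} [Ring B]
    (k : a.ring →+* B) : (a.snoc x).Through (k.comp a.map) ↔ IsUnit (k x) := by
  constructor
  · rintro ⟨k', hk'⟩
    have : k'.comp (a.snocMap x) = k := a.hom_ext hk'
    rw [← this]
    exact (a.isUnit_snocMap x).map k'
  · intro h
    obtain ⟨k', hk'⟩ := a.exists_snoc_lift x k h
    exact ⟨k', by rw [← a.snocMap_comp_map, ← RingHom.comp_assoc, hk']⟩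

theorem Fraction.Through.comp {a : Fraction A} {B B' : Type u} [Ring B] [Ring B'] {φ : A →+* B}
    (h : a.Through φ) (f : B →+* B') : a.Through (f.comp φ) := by
  obtain ⟨k, rfl⟩ := h
  exact ⟨f.comp k, rfl⟩

theorem Fraction.through_map (a : Fraction A) : a.Through a.map := ⟨RingHom.id _, rfl⟩

/-- `h : A_𝐚 → C_𝐛` exhibits `C_𝐛` as the pushout of `A_𝐚` along `π : A → C`. -/
structure Fraction.IsPush (π : A →+* C) (a : Fraction A) (b : Fraction C)
    (h : a.ring →+* b.ring) : Prop where
  comm : h.comp a.map = b.map.comp π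
  univ : ∀ {B : Type u} [Ring B] (ψ : C →+* B), a.Through (ψ.comp π) → b.Through ψ

namespace Fraction.IsPush

variable {π : A →+* C} {a : Fraction A} {b : Fraction C} {h : a.ring →+* b.ring}

theorem through_iff (H : IsPush π a b h) {B : Type u} [Ring B] (ψ : C →+* B) :
    b.Through ψ ↔ a.Through (ψ.comp π) := by
  refine ⟨?_, H.univ ψ⟩
  rintro ⟨k, rfl⟩
  exact ⟨k.comp h, by rw [RingHom.comp_assoc, H.comm, RingHom.comp_assoc]⟩

theorem nil (π : A →+* C) : IsPush π (Fraction.nil A) (Fraction.nil C) π :=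
  ⟨rfl, fun ψ _ => through_nil ψ⟩

/-- Over a map `k` out of `C_𝐛`, inverting `x` and inverting `h x` are the same condition, namely
that `k (h x)` be a unit. So pushouts of fractions are built entry by entry. -/
theorem snoc (H : IsPush π a b h) (x : a.ring) :
    ∃ h', IsPush π (a.snoc x) (b.snoc (h x)) h' := by
  obtain ⟨h', hh'⟩ := a.exists_snoc_lift x ((b.snocMap (h x)).comp h) (b.isUnit_snocMap (h x))
  refine ⟨h', ?_, fun {B} _ ψ hψ => ?_⟩
  · rw [← a.snocMap_comp_map, ← RingHom.comp_assoc, hh', RingHom.comp_assoc, H.comm,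
      ← RingHom.comp_assoc, b.snocMap_comp_map]
  · obtain ⟨k', hk'⟩ := hψ
    have ha : a.Through (ψ.comp π) := ⟨k'.comp (a.snocMap x), hk'⟩
    obtain ⟨k, rfl⟩ := H.univ ψ ha
    rw [b.through_snoc]
    have : k'.comp (a.snocMap x) = k.comp h := a.hom_ext (by
      rw [RingHom.comp_assoc, RingHom.comp_assoc, H.comm]; exact hk')
    have h2 : k (h x) = k' (a.snocMap x x) := (RingHom.congr_fun this x).symm
    rw [h2]
    exact (a.isUnit_snocMap x).map k'

/-- The range of `h` contains the image of `C` and receives `A_𝐚`, so the pushout property maps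
`C_𝐛` into it; composed with the inclusion this is the identity by `hom_ext`. -/
theorem surjective (H : IsPush π a b h) (hπ : Function.Surjective π) :
    Function.Surjective h := by
  have hr : ∀ c, b.map c ∈ h.range := fun c => by
    obtain ⟨x, rfl⟩ := hπ c
    exact ⟨a.map x, RingHom.congr_fun H.comm x⟩
  let ψ : C →+* h.range := b.map.codRestrict h.range hr
  obtain ⟨k, hk⟩ := H.univ ψ ⟨h.rangeRestrict, RingHom.ext fun x =>
    Subtype.ext (RingHom.congr_fun H.comm x)⟩
  have : h.range.subtype.comp k = RingHom.id b.ring := b.hom_ext (by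
    rw [RingHom.comp_assoc, hk]; rfl)
  intro y
  have h2 : ((k y : h.range) : b.ring) = y := RingHom.congr_fun this y
  rw [← h2]
  exact (k y).2

/-- The quotient of `A_𝐚` by the ideal generated by `ker π` receives compatible maps from `A_𝐚` and
from `C`. The pushout property then makes the quotient map factor through `h`, so `ker h` is no
larger than that ideal. -/
theorem ker_eq (H : IsPush π a b h) (hπ : Function.Surjective π) (x : a.ring) :
    h x = 0 ↔ x ∈ TwoSidedIdeal.span (a.map '' (TwoSidedIdeal.ker π : Set A)) := by
  set J := TwoSidedIdeal.span (a.map '' (TwoSidedIdeal.ker π : Set A)) with hJ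
  constructor
  · intro hx
    let q : a.ring →+* J.ringCon.Quotient := J.ringCon.mk'
    have hq : ∀ y, q y = 0 ↔ y ∈ J := fun y => by
      have := J.rel_iff y 0
      rw [sub_zero] at this
      rw [← this, ← map_zero q]
      exact RingCon.eq _
    have hk : RingHom.ker π ≤ RingHom.ker (q.comp a.map) := fun y hy =>
      (hq _).2 (TwoSidedIdeal.subset_span ⟨y, (TwoSidedIdeal.mem_ker π).2 hy, rfl⟩)
    obtain ⟨ψ, hψ⟩ : ∃ ψ : C →+* J.ringCon.Quotient, ψ.comp π = q.comp a.map :=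
      ⟨_, π.liftOfSurjective_comp hπ ⟨q.comp a.map, hk⟩⟩
    obtain ⟨k, rfl⟩ := H.univ ψ ⟨q, hψ.symm⟩
    have : k.comp h = q := a.hom_ext (by
      rw [RingHom.comp_assoc, H.comm, ← RingHom.comp_assoc, hψ])
    rw [← hq, ← this, RingHom.comp_apply, hx, map_zero]
  · intro hx
    have : J ≤ TwoSidedIdeal.ker h := TwoSidedIdeal.span_le.2 (by
      rintro _ ⟨y, hy, rfl⟩
      refine (TwoSidedIdeal.mem_ker h).2 ?_
      have h1 : h (a.map y) = b.map (π y) := RingHom.congr_fun H.comm y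
      rw [h1, (TwoSidedIdeal.mem_ker π).1 hy, map_zero])
    exact (TwoSidedIdeal.mem_ker h).1 (this hx)

end Fraction.IsPush

namespace Fraction

theorem exists_isPush (π : A →+* C) (a : Fraction A) : ∃ b h, IsPush π a b h := by
  induction a using Fraction.induction with
  | h0 => exact ⟨_, _, IsPush.nil π⟩
  | h1 a x ih =>
    obtain ⟨b, h, H⟩ := ih
    exact ⟨_, H.snoc x⟩

/-- Each new entry of a fraction of `C` lifts, because the pushout map built so far is surjective.
-/
theorem exists_isPush_of_surjective (π : A →+* C) (hπ : Function.Surjective π) (b : Fraction C) :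
    ∃ a h, IsPush π a b h := by
  induction b using Fraction.induction with
  | h0 => exact ⟨_, _, IsPush.nil π⟩
  | h1 b x ih =>
    obtain ⟨a, h, H⟩ := ih
    obtain ⟨y, rfl⟩ := H.surjective hπ x
    exact ⟨_, H.snoc y⟩

/-- The entries of `𝐛` are appended to `𝐚` one at a time, each transported to the localization
already constructed. -/
theorem exists_inter (a b : Fraction A) : ∃ c : Fraction A, ∀ {B : Type u} [Ring B]
    (φ : A →+* B), c.Through φ ↔ a.Through φ ∧ b.Through φ := by
  induction b using Fraction.induction with
  | h0 => exact ⟨a, fun φ => (and_iff_left (through_nil φ)).symm⟩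
  | h1 b x ih =>
    obtain ⟨c, hc⟩ := ih
    -- Applying the induction hypothesis to the universal case `c.map` produces the map `A_𝐛 → A_𝐜`
    -- along which the next entry is transported.
    obtain ⟨l, hl⟩ := ((hc c.map).1 c.through_map).2
    refine ⟨c.snoc (l x), fun {B} _ φ => ⟨fun h => ?_, fun ⟨ha, hb⟩ => ?_⟩⟩
    · obtain ⟨k, rfl⟩ : c.Through φ := by
        obtain ⟨k, rfl⟩ := h
        exact ⟨k.comp (c.snocMap _), rfl⟩
      refine ⟨((hc _).1 ⟨k, rfl⟩).1, ?_⟩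
      rw [c.through_snoc] at h
      rw [← hl, ← RingHom.comp_assoc, b.through_snoc]
      exact h
    · have hb' : b.Through φ := by
        obtain ⟨k, rfl⟩ := hb
        exact ⟨k.comp (b.snocMap _), rfl⟩
      obtain ⟨k, rfl⟩ := (hc φ).2 ⟨ha, hb'⟩
      rw [← hl, ← RingHom.comp_assoc, b.through_snoc] at hb
      rw [c.through_snoc]
      exact hb

/-- A fraction `𝐜` with `D(𝐜) = D(𝐚) ∩ D(𝐛)`. -/
def inter (a b : Fraction A) : Fraction A := (exists_inter a b).choose

theorem inter_through (a b : Fraction A) {B : Type u} [Ring B] (φ : A →+* B) :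
    (a.inter b).Through φ ↔ a.Through φ ∧ b.Through φ := (exists_inter a b).choose_spec φ

theorem mem_D_ofHom {B : RingCat.{u}} [Nontrivial B] (φ : A →+* B) (a : Fraction A) :
    FullSpec.ofHom φ ∈ a.D ↔ a.Through φ := ofHom_mem_D φ a

theorem D_subset_iff_through (a b : Fraction A) : b.D ⊆ a.D ↔ a.Through b.map := D_subset_iff a b

theorem D_inter (a b : Fraction A) : (a.inter b).D = a.D ∩ b.D := by
  ext S
  obtain ⟨B, hB, φ, rfl⟩ := exists_eq_ofHom S
  simp only [Set.mem_inter_iff, mem_D_ofHom, inter_through]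

theorem D_nil (A : RingCat.{u}) : (nil A).D = Set.univ := by
  ext S
  obtain ⟨B, hB, φ, rfl⟩ := exists_eq_ofHom S
  simp only [mem_D_ofHom, through_nil, Set.mem_univ]

theorem D_snoc_subset (a : Fraction A) (x : a.ring) : (a.snoc x).D ⊆ a.D :=
  D_subset_of_hom (a.snocMap x) rfl

theorem isTopologicalBasis_D (A : RingCat.{u}) :
    IsTopologicalBasis (Set.range (Fraction.D (A := A))) where
  exists_subset_inter := by
    rintro _ ⟨a, rfl⟩ _ ⟨b, rfl⟩ S hS
    exact ⟨_, ⟨a.inter b, rfl⟩, by rwa [D_inter], (D_inter a b).subset⟩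
  sUnion_eq := Set.eq_univ_of_univ_subset fun S _ =>
    ⟨_, ⟨nil A, rfl⟩, by rw [D_nil]; trivial⟩
  eq_generateFrom := rfl

theorem exists_mem_D_subset {S : FullSpec A} {U : Set (FullSpec A)} (hU : IsOpen U) (hS : S ∈ U) :
    ∃ a : Fraction A, S ∈ a.D ∧ a.D ⊆ U := by
  obtain ⟨_, ⟨a, rfl⟩, h1, h2⟩ := (isTopologicalBasis_D A).exists_subset_of_mem_open hS hU
  exact ⟨a, h1, h2⟩

theorem nontrivial_of_mem_D {S : FullSpec A} {a : Fraction A} (h : S ∈ a.D) :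
    Nontrivial a.ring := by
  obtain ⟨B, hB, φ, rfl⟩ := exists_eq_ofHom S
  obtain ⟨k, -⟩ := (mem_D_ofHom φ a).1 h
  exact k.domain_nontrivial

end Fraction

/-! ### Points are separated by the basic open sets -/

/-- Since `f` reflects units, `φₙ` and `f ∘ φₙ` invert the same elements at every stage. The chain
and the extended map are compared as one pair because each next set depends on the map. -/
theorem chainOfHom_comp {B B' : Type u} [Ring B] [Ring B'] (φ : A →+* B) (f : B →+* B')
    (hf : ∀ x, IsUnit (f x) → IsUnit x) (n : ℕ) :
    chainOfHom A (f.comp φ) n = ⟨(chainOfHom A φ n).1, f.comp (chainOfHom A φ n).2⟩ := by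
  induction n with
  | zero => rfl
  | succ n ih =>
    change (⟨(chainOfHom A (f.comp φ) n).1.snoc {x | IsUnit ((chainOfHom A (f.comp φ) n).2 x)},
      Loc.lift (chainOfHom A (f.comp φ) n).2 fun _ hs => hs⟩ :
        Σ s : Chain A (n + 1), (s.ring →+* B')) = _
    rw [ih]
    have hs : {x | IsUnit ((f.comp (chainOfHom A φ n).2) x)} =
        {x | IsUnit ((chainOfHom A φ n).2 x)} :=
      Set.ext fun x => ⟨fun h => hf _ h, fun h => IsUnit.map f h⟩
    -- The set is generalized to a variable so that the equality `hs` can be substituted without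
    -- transporting maps between different localizations.
    have key : ∀ (S : Set (chainOfHom A φ n).1.ring)
        (hS : ∀ s ∈ S, IsUnit ((f.comp (chainOfHom A φ n).2) s))
        (hS' : S = {x | IsUnit ((chainOfHom A φ n).2 x)}),
        (⟨(chainOfHom A φ n).1.snoc S, Loc.lift (f.comp (chainOfHom A φ n).2) hS⟩ :
          Σ s : Chain A (n + 1), (s.ring →+* B')) =
        ⟨(chainOfHom A φ (n + 1)).1, f.comp (chainOfHom A φ (n + 1)).2⟩ := by
      rintro S hS rfl
      refine Sigma.ext rfl (heq_of_eq (Loc.hom_ext ?_))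
      refine (Loc.lift_comp _ hS).trans ?_
      exact (congrArg f.comp (chainOfHom_comp_step A φ n)).symm
    exact key _ _ hs

/-- Pairs of values in `B × B'` of elements of the rings `A_𝐚` through which both homomorphisms
factor. -/
def commonSubring {B B' : Type u} [Ring B] [Ring B'] (φ : A →+* B) (ψ : A →+* B') :
    Subring (B × B') where
  carrier := {p | ∃ (a : Fraction A) (k : a.ring →+* B × B') (x : a.ring),
    k.comp a.map = φ.prod ψ ∧ k x = p}
  mul_mem' := by
    rintro _ _ ⟨a, k, x, hk, rfl⟩ ⟨b, l, y, hl, rfl⟩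
    -- Elements over different fractions are multiplied after moving both to the fraction of `D(𝐚) ∩
    -- D(𝐛)`.
    obtain ⟨m, hm⟩ := (a.inter_through b _).2 ⟨⟨k, hk⟩, ⟨l, hl⟩⟩
    obtain ⟨⟨i, hi⟩, ⟨j, hj⟩⟩ := (a.inter_through b _).1 (a.inter b).through_map
    have h1 : m.comp i = k := a.hom_ext (by rw [RingHom.comp_assoc, hi, hm, hk])
    have h2 : m.comp j = l := b.hom_ext (by rw [RingHom.comp_assoc, hj, hm, hl])
    exact ⟨_, m, i x * j y, hm, by rw [map_mul, ← h1, ← h2]; rfl⟩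
  add_mem' := by
    rintro _ _ ⟨a, k, x, hk, rfl⟩ ⟨b, l, y, hl, rfl⟩
    obtain ⟨m, hm⟩ := (a.inter_through b _).2 ⟨⟨k, hk⟩, ⟨l, hl⟩⟩
    obtain ⟨⟨i, hi⟩, ⟨j, hj⟩⟩ := (a.inter_through b _).1 (a.inter b).through_map
    have h1 : m.comp i = k := a.hom_ext (by rw [RingHom.comp_assoc, hi, hm, hk])
    have h2 : m.comp j = l := b.hom_ext (by rw [RingHom.comp_assoc, hj, hm, hl])
    exact ⟨_, m, i x + j y, hm, by rw [map_add, ← h1, ← h2]; rfl⟩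
  one_mem' := ⟨Fraction.nil A, φ.prod ψ, 1, rfl, map_one _⟩
  zero_mem' := ⟨Fraction.nil A, φ.prod ψ, 0, rfl, map_zero _⟩
  neg_mem' := by
    rintro _ ⟨a, k, x, hk, rfl⟩
    exact ⟨a, k, -x, hk, map_neg _ _⟩

/-- If `p` is the value of `x ∈ A_𝐚`, the value of `x⁻¹ ∈ A_(𝐚,x)` is again a common value, so the
inverse stays in the subring. -/
theorem commonSubring_isUnit {B B' : Type u} [Ring B] [Ring B'] (φ : A →+* B) (ψ : A →+* B')
    (p : commonSubring φ ψ) (h : ∀ (a : Fraction A) (x : a.ring) (k : a.ring →+* B × B'),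
      k x = p.1 → k.comp a.map = φ.prod ψ → (a.snoc x).Through (φ.prod ψ)) : IsUnit p := by
  obtain ⟨_, a, k, x, hk, rfl⟩ := p
  obtain ⟨k', hk'⟩ := h a x k rfl hk
  have e : k'.comp (a.snocMap x) = k := a.hom_ext (hk'.trans hk.symm)
  obtain ⟨u, hu⟩ := a.isUnit_snocMap x
  have hx : k x = k' u := by rw [← e, hu]; rfl
  refine ⟨⟨⟨k x, a, k, x, hk, rfl⟩, ⟨k' (u⁻¹ : ((a.snoc x).ring)ˣ), a.snoc x, k', _, hk', rfl⟩,
    Subtype.ext ?_, Subtype.ext ?_⟩, rfl⟩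
  · change k x * _ = 1
    rw [hx, ← map_mul, Units.mul_inv, map_one]
  · change _ * k x = 1
    rw [hx, ← map_mul, Units.inv_mul, map_one]

theorem Fraction.through_prod (a : Fraction A) {B B' : Type u} [Ring B] [Ring B'] (φ : A →+* B)
    (ψ : A →+* B') : a.Through (φ.prod ψ) ↔ a.Through φ ∧ a.Through ψ := by
  constructor
  · exact fun h => ⟨h.comp (RingHom.fst B B'), h.comp (RingHom.snd B B')⟩
  · rintro ⟨⟨k, rfl⟩, ⟨l, rfl⟩⟩
    exact ⟨k.prod l, rfl⟩

/-- Both projections of the common subring reflect units: if one component of the value of `x ∈ A_𝐚`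
is invertible, the corresponding map factors through `A_(𝐚,x)`, hence so does the other. Both chains
therefore equal that of `A → commonSubring φ ψ`. -/
theorem chainOfHom_fst_eq_of_through {B B' : Type u} [Ring B] [Ring B'] (φ : A →+* B)
    (ψ : A →+* B') (h : ∀ a : Fraction A, a.Through φ ↔ a.Through ψ) (n : ℕ) :
    (chainOfHom A φ n).1 = (chainOfHom A ψ n).1 := by
  let χ : A →+* commonSubring φ ψ := (φ.prod ψ).codRestrict _
    fun x => ⟨Fraction.nil A, φ.prod ψ, x, rfl, rfl⟩
  let f : commonSubring φ ψ →+* B := (RingHom.fst B B').comp (commonSubring φ ψ).subtype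
  let g : commonSubring φ ψ →+* B' := (RingHom.snd B B').comp (commonSubring φ ψ).subtype
  have hf : ∀ p, IsUnit (f p) → IsUnit p := fun p hp => by
    refine commonSubring_isUnit φ ψ p fun a x k hx hk => ?_
    have h1 : (a.snoc x).Through φ := by
      have : φ = ((RingHom.fst B B').comp k).comp a.map := by rw [RingHom.comp_assoc, hk]; rfl
      rw [this, a.through_snoc]
      change IsUnit (k x).1
      rw [hx]; exact hp
    exact (Fraction.through_prod _ _ _).2 ⟨h1, (h _).1 h1⟩
  have hg : ∀ p, IsUnit (g p) → IsUnit p := fun p hp => by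
    refine commonSubring_isUnit φ ψ p fun a x k hx hk => ?_
    have h1 : (a.snoc x).Through ψ := by
      have : ψ = ((RingHom.snd B B').comp k).comp a.map := by rw [RingHom.comp_assoc, hk]; rfl
      rw [this, a.through_snoc]
      change IsUnit (k x).2
      rw [hx]; exact hp
    exact (Fraction.through_prod _ _ _).2 ⟨(h _).2 h1, h1⟩
  have e1 : (chainOfHom A φ n).1 = (chainOfHom A χ n).1 :=
    congrArg Sigma.fst (chainOfHom_comp χ f hf n)
  have e2 : (chainOfHom A ψ n).1 = (chainOfHom A χ n).1 :=
    congrArg Sigma.fst (chainOfHom_comp χ g hg n)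
  rw [e1, e2]

theorem FullSpec.ext_of_mem_D {S T : FullSpec A} (h : ∀ a : Fraction A, S ∈ a.D ↔ T ∈ a.D) :
    S = T := by
  obtain ⟨B, hB, φ, rfl⟩ := Fraction.exists_eq_ofHom S
  obtain ⟨B', hB', ψ, rfl⟩ := Fraction.exists_eq_ofHom T
  simp only [Fraction.mem_D_ofHom] at h
  exact Subtype.ext (funext fun n => chainOfHom_fst_eq_of_through φ ψ h n)

end Factorization

/-! ### A criterion for a ringed space to be an open part of `(Z(ℐ), 𝒪_X / ℐ)` -/

section Criterion

variable {X Y : SheafedSpace RingCat.{u}}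

/-- Local sections with prescribed germs agree on overlaps, since germs determine sections of a
sheaf, and so they glue. This turns the stalkwise description of `𝒪_X / ℐ` into honest sections on
`Y`. -/
theorem exists_section_of_germs (U : Opens Y) (g : ∀ y : U, Y.presheaf.stalk y.1)
    (hg : ∀ y : U, ∃ (V : Opens Y) (_ : y.1 ∈ V) (s : Y.presheaf.obj (op V)),
      ∀ (w : U) (hw : w.1 ∈ V), Y.presheaf.germ V w.1 hw s = g w) :
    ∃ s : Y.presheaf.obj (op U), ∀ y : U, Y.presheaf.germ U y.1 y.2 s = g y := by
  choose V hV s hs using hg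
  let W : U → Opens Y := fun y => V y ⊓ U
  let t : ∀ y : U, Y.presheaf.obj (op (W y)) := fun y =>
    Y.presheaf.map (homOfLE (inf_le_left : W y ≤ V y)).op (s y)
  have ht : ∀ (y : U) (w : Y) (hw : w ∈ W y), Y.presheaf.germ (W y) w hw (t y) = g ⟨w, hw.2⟩ :=
    fun y w hw => (TopCat.Presheaf.germ_res_apply Y.presheaf _ w hw (s y)).trans
      (hs y ⟨w, hw.2⟩ hw.1)
  have hc : TopCat.Presheaf.IsCompatible Y.presheaf W t := by
    intro y y'
    refine TopCat.Presheaf.section_ext Y.sheaf _ _ _ fun w hw => ?_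
    refine (TopCat.Presheaf.germ_res_apply Y.presheaf _ w hw _).trans (Eq.trans ?_
      (TopCat.Presheaf.germ_res_apply Y.presheaf _ w hw _).symm)
    rw [ht y w hw.1, ht y' w hw.2]
  obtain ⟨r, hr, -⟩ := Y.sheaf.existsUnique_gluing' W U (fun y => homOfLE inf_le_right)
    (fun y hy => Opens.mem_iSup.2 ⟨⟨y, hy⟩, hV ⟨y, hy⟩, hy⟩) t hc
  refine ⟨r, fun y => ?_⟩
  rw [← ht y y.1 ⟨hV y, y.2⟩, ← hr y]
  exact (TopCat.Presheaf.germ_res_apply Y.presheaf _ y.1 _ r).symm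

theorem section_ext {U : Opens Y} {s t : Y.presheaf.obj (op U)}
    (h : ∀ (y : Y) (hy : y ∈ U), Y.presheaf.germ U y hy s = Y.presheaf.germ U y hy t) : s = t :=
  TopCat.Presheaf.section_ext Y.sheaf U s t h

/-- The map on stalks induced by a morphism of ringed spaces. -/
def stalkHom (p : Y ⟶ X) (y : Y) :
    X.presheaf.stalk (p.hom.base y) →+* Y.presheaf.stalk y := (p.hom.stalkMap y).hom

/-- The map on sections induced by a morphism of ringed spaces. -/
def sectionHom (p : Y ⟶ X) (U : Opens X) :
    X.presheaf.obj (op U) →+* Y.presheaf.obj (op ((Opens.map p.hom.base).obj U)) :=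
  (p.hom.c.app (op U)).hom

theorem stalkHom_germ (p : Y ⟶ X) (y : Y) (U : Opens X) (hy : p.hom.base y ∈ U)
    (s : X.presheaf.obj (op U)) :
    stalkHom p y (X.presheaf.germ U (p.hom.base y) hy s) =
      Y.presheaf.germ ((Opens.map p.hom.base).obj U) y hy (sectionHom p U s) :=
  PresheafedSpace.stalkMap_germ_apply p.hom U y hy s

theorem sectionHom_res (p : Y ⟶ X) {U V : Opens X} (i : V ⟶ U) (s : X.presheaf.obj (op U)) :
    sectionHom p V (X.presheaf.map i.op s) =
      Y.presheaf.map ((Opens.map p.hom.base).map i).op (sectionHom p U s) :=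
  ConcreteCategory.congr_hom (p.hom.c.naturality i.op) s

/-- `p : Y → X` identifies `Y` with an open subspace of the ringed space `(Z(ℐ), 𝒪_X / ℐ)`. -/
structure IsOpenInClosed (p : Y ⟶ X) (I : IdealSheaf X) : Prop where
  injective : Function.Injective p.hom.base
  inducing : Topology.IsInducing p.hom.base
  exists_range_eq : ∃ W : Set X, IsOpen W ∧ Set.range p.hom.base = W ∩ I.zeroLocus
  surjective : ∀ y, Function.Surjective (stalkHom p y)
  ker : ∀ y g, stalkHom p y g = 0 ↔ g ∈ I.stalk (p.hom.base y)

namespace IsOpenInClosed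

variable {p : Y ⟶ X} {I : IdealSheaf X} (H : IsOpenInClosed p I)
include H

theorem mem_zeroLocus (y : Y) : p.hom.base y ∈ I.zeroLocus := by
  obtain ⟨W, -, hW⟩ := H.exists_range_eq
  exact (hW.subset ⟨y, rfl⟩).2

/-- The map `Y → Z(ℐ)`. -/
def baseMap (y : Y) : I.zeroLocus := ⟨p.hom.base y, H.mem_zeroLocus y⟩

theorem isOpenEmbedding_baseMap : Topology.IsOpenEmbedding H.baseMap := by
  have h1 : Topology.IsInducing H.baseMap :=
    Topology.IsInducing.of_comp_iff Topology.IsInducing.subtypeVal |>.1 H.inducing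
  refine ⟨⟨h1, fun y y' h => H.injective (congrArg Subtype.val h)⟩, ?_⟩
  obtain ⟨W, hW, hr⟩ := H.exists_range_eq
  refine isOpen_induced_iff.2 ⟨W, hW, ?_⟩
  ext z
  constructor
  · intro hz
    obtain ⟨y, hy⟩ := hr.superset ⟨hz, z.2⟩
    exact ⟨y, Subtype.ext hy⟩
  · rintro ⟨y, rfl⟩
    exact (hr.subset ⟨y, rfl⟩).1

theorem ringCon_le_ker (y : Y) : (I.stalk (p.hom.base y)).ringCon ≤ RingCon.ker (stalkHom p y) := by
  rw [RingCon.le_def]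
  intro g g' h
  refine (RingCon.ker_apply _).2 ?_
  rw [← sub_eq_zero, ← map_sub]
  exact (H.ker y _).2 ((TwoSidedIdeal.rel_iff _ _ _).1 h)

/-- The map `𝒪_{X,y} / ℐ_y → 𝒪_{Y,y}`. -/
def quotHom (y : Y) : I.quotStalk (p.hom.base y) →+* Y.presheaf.stalk y :=
  RingCon.lift _ (stalkHom p y) (H.ringCon_le_ker y)

theorem quotHom_mk (y : Y) (g : X.presheaf.stalk (p.hom.base y)) :
    H.quotHom y ((I.stalk (p.hom.base y)).ringCon.mk' g) = stalkHom p y g := rfl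

theorem quotHom_quotGerm (y : Y) {U : Opens X} (s : X.presheaf.obj (op U))
    (hy : p.hom.base y ∈ U) : H.quotHom y (I.quotGerm s _ hy) =
      Y.presheaf.germ ((Opens.map p.hom.base).obj U) y hy (sectionHom p U s) :=
  stalkHom_germ p y U hy s

theorem quotHom_bijective (y : Y) : Function.Bijective (H.quotHom y) := by
  constructor
  · rw [injective_iff_map_eq_zero]
    intro q hq
    obtain ⟨g, rfl⟩ := RingCon.mk'_surjective _ q
    rw [quotHom_mk, H.ker] at hq
    rw [← map_zero (I.stalk (p.hom.base y)).ringCon.mk']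
    refine (RingCon.eq _).2 ((TwoSidedIdeal.rel_iff _ _ _).2 ?_)
    rwa [sub_zero]
  · intro g
    obtain ⟨g', rfl⟩ := H.surjective y g
    exact ⟨_, H.quotHom_mk y g'⟩

/-- The map `Y → Z(ℐ)` as a morphism of topological spaces. -/
def baseHom : (Y : TopCat) ⟶ TopCat.of I.zeroLocus :=
  TopCat.ofHom ⟨H.baseMap, H.isOpenEmbedding_baseMap.continuous⟩

theorem exists_pullback (V : Opens I.zeroLocus) (t : I.quotSections V) :
    ∃ s : Y.presheaf.obj (op ((Opens.map H.baseHom).obj V)),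
      ∀ (y : Y) (hy : H.baseMap y ∈ V), Y.presheaf.germ _ y hy s = H.quotHom y (t.1 ⟨_, hy⟩) := by
  obtain ⟨s, hs⟩ := exists_section_of_germs ((Opens.map H.baseHom).obj V)
    (fun y => H.quotHom y.1 (t.1 ⟨H.baseMap y.1, y.2⟩)) (by
      intro y
      obtain ⟨U, hU, r, hr⟩ := t.2 ⟨H.baseMap y.1, y.2⟩
      refine ⟨(Opens.map p.hom.base).obj U, hU, sectionHom p U r, fun w hw => ?_⟩
      rw [hr ⟨H.baseMap w.1, w.2⟩ hw]
      exact (H.quotHom_quotGerm w.1 r hw).symm)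
  exact ⟨s, fun y hy => hs ⟨y, hy⟩⟩

/-- The pull back of sections of `𝒪_X / ℐ` to `Y`. -/
def pullback (V : Opens I.zeroLocus) :
    I.quotSections V →+* Y.presheaf.obj (op ((Opens.map H.baseHom).obj V)) where
  toFun t := (H.exists_pullback V t).choose
  map_one' := section_ext fun y hy => by
    rw [(H.exists_pullback V _).choose_spec y hy, map_one]
    exact map_one _
  map_mul' t t' := section_ext fun y hy => by
    rw [map_mul, (H.exists_pullback V _).choose_spec y hy,
      (H.exists_pullback V _).choose_spec y hy, (H.exists_pullback V _).choose_spec y hy]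
    exact map_mul (H.quotHom y) _ _
  map_zero' := section_ext fun y hy => by
    rw [(H.exists_pullback V _).choose_spec y hy, map_zero]
    exact map_zero _
  map_add' t t' := section_ext fun y hy => by
    rw [map_add, (H.exists_pullback V _).choose_spec y hy,
      (H.exists_pullback V _).choose_spec y hy, (H.exists_pullback V _).choose_spec y hy]
    exact map_add (H.quotHom y) _ _

theorem germ_pullback (V : Opens I.zeroLocus) (t : I.quotSections V) (y : Y)
    (hy : H.baseMap y ∈ V) :
    Y.presheaf.germ ((Opens.map H.baseHom).obj V) y hy (H.pullback V t) =
      H.quotHom y (t.1 ⟨_, hy⟩) := (H.exists_pullback V t).choose_spec y hy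

/-- The morphism of ringed spaces `Y → (Z(ℐ), 𝒪_X / ℐ)`. -/
def toClosedSub : Y ⟶ I.closedSub where
  hom :=
  { base := H.baseHom
    c :=
    { app := fun V => RingCat.ofHom (H.pullback V.unop)
      naturality := fun V W i => by
        refine RingCat.hom_ext (RingHom.ext fun t => section_ext fun y hy => ?_)
        refine (H.germ_pullback W.unop _ y hy).trans (Eq.trans ?_
          (TopCat.Presheaf.germ_res_apply Y.presheaf ((Opens.map H.baseHom).map i.unop) y hy
            _).symm)
        exact (H.germ_pullback V.unop t y (i.unop.le hy)).symm } }

/-- The image in `Z(ℐ)` of an open subset of `Y`. -/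
def imageOpens (V : Opens Y) : Opens I.zeroLocus :=
  ⟨H.baseMap '' V, H.isOpenEmbedding_baseMap.isOpenMap _ V.2⟩

/-- Germs decide injectivity. For surjectivity, the stalk isomorphisms translate a section of `𝒪_Y`
into a family in the quotient stalks; the content is that this family is locally given by sections
of `𝒪_X`. -/
theorem pullback_bijective (V : Opens Y) :
    Function.Bijective (H.pullback (H.imageOpens V)) := by
  constructor
  · intro t t' h
    refine Subtype.ext (funext ?_)
    rintro ⟨_, y, hy, rfl⟩
    refine (H.quotHom_bijective y).1 ?_
    have h1 := H.germ_pullback (H.imageOpens V) t y ⟨y, hy, rfl⟩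
    have h2 := H.germ_pullback (H.imageOpens V) t' y ⟨y, hy, rfl⟩
    rw [h] at h1
    exact h1.symm.trans h2
  · intro s
    let q : ∀ y : Y, y ∈ V → I.quotStalk (p.hom.base y) := fun y hy =>
      ((H.quotHom_bijective y).2 (Y.presheaf.germ _ y (⟨y, hy, rfl⟩ :
        y ∈ (Opens.map H.baseHom).obj (H.imageOpens V)) s)).choose
    have hq : ∀ (y : Y) (hy : y ∈ V), H.quotHom y (q y hy) = Y.presheaf.germ _ y (⟨y, hy, rfl⟩ :
        y ∈ (Opens.map H.baseHom).obj (H.imageOpens V)) s :=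
      fun y hy => ((H.quotHom_bijective y).2 _).choose_spec
    -- A point of the image equals some `H.baseMap y` only propositionally, so the chosen element is
    -- characterized after a cast, for all such `y` at once.
    have hex : ∀ z : H.imageOpens V,
        ∃ x : I.quotStalk z.1.1, ∀ (y : Y) (e : H.baseMap y = z.1),
          H.quotHom y (cast (by rw [← e]; rfl) x) = Y.presheaf.germ _ y (by
            change H.baseMap y ∈ H.imageOpens V; rw [e]; exact z.2 :
            y ∈ (Opens.map H.baseHom).obj (H.imageOpens V)) s := by
      rintro ⟨_, y, hy, rfl⟩
      refine ⟨q y hy, fun y' e => ?_⟩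
      obtain rfl := H.isOpenEmbedding_baseMap.injective e
      exact hq y' hy
    choose t ht using hex
    have ht' : ∀ (y : Y) (hy : y ∈ V), t ⟨H.baseMap y, y, hy, rfl⟩ = q y hy := fun y hy =>
      (H.quotHom_bijective y).1 ((ht ⟨H.baseMap y, y, hy, rfl⟩ y rfl).trans (hq y hy).symm)
    refine ⟨⟨t, ?_⟩, ?_⟩
    · rintro ⟨_, y, hy, rfl⟩
      obtain ⟨g, hg⟩ := RingCon.mk'_surjective _ (q y hy)
      obtain ⟨U, hU, r, rfl⟩ := TopCat.Presheaf.exists_germ_eq _ g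
      have h1 := (congrArg (H.quotHom y) hg).trans (hq y hy)
      rw [quotHom_mk, stalkHom_germ] at h1
      obtain ⟨W, hyW, i, j, hW⟩ := TopCat.Presheaf.germ_eq Y.presheaf y _ _ _ _ h1
      -- The lifted section `r` agrees with `s` only over an open set of `Y`; as the topology is
      -- induced, that set is cut out by an open `O` of `X`, and `r` represents the family over `U ⊓
      -- O`.
      obtain ⟨O, hO, hOW⟩ := H.inducing.isOpen_iff.1 W.2
      have hyO : p.hom.base y ∈ O := by
        change y ∈ p.hom.base ⁻¹' O
        rw [hOW]; exact hyW
      refine ⟨U ⊓ ⟨O, hO⟩, ⟨hU, hyO⟩, X.presheaf.map (homOfLE inf_le_left).op r, ?_⟩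
      rintro ⟨_, w, hw, rfl⟩ hwU
      refine (ht' w hw).trans ((H.quotHom_bijective w).1 ?_)
      have hwW : w ∈ W := by
        change w ∈ W.carrier
        rw [← hOW]; exact hwU.2
      have e1 : I.quotGerm (X.presheaf.map (homOfLE inf_le_left).op r) (p.hom.base w) hwU =
          I.quotGerm r (p.hom.base w) hwU.1 :=
        congrArg (I.stalk _).ringCon.mk'
          (TopCat.Presheaf.germ_res_apply X.presheaf (homOfLE inf_le_left) _ hwU r)
      refine (hq w hw).trans (Eq.trans ?_ (congrArg (H.quotHom w) e1).symm)
      rw [H.quotHom_quotGerm w r hwU.1]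
      have e2 := congrArg (Y.presheaf.germ W w hwW) hW
      refine (TopCat.Presheaf.germ_res_apply Y.presheaf j w hwW s).symm.trans (e2.symm.trans ?_)
      exact TopCat.Presheaf.germ_res_apply Y.presheaf i w hwW _
    · refine section_ext ?_
      rintro y ⟨y', hy, e⟩
      obtain rfl := H.isOpenEmbedding_baseMap.injective e
      refine (H.germ_pullback (H.imageOpens V) ⟨t, _⟩ y'
        ⟨y', hy, rfl⟩).trans ?_
      refine Eq.trans (congrArg (H.quotHom y') (ht' y' hy)) (hq y' hy)

theorem isOpenImmersion_toClosedSub : SheafedSpace.IsOpenImmersion H.toClosedSub where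
  base_open := H.isOpenEmbedding_baseMap
  c_iso V := by
    refine (ConcreteCategory.isIso_iff_bijective _).2 ?_
    exact H.pullback_bijective V

/-- If `p` is onto `Z(ℐ)`, then `Y ≅ (Z(ℐ), 𝒪_X / ℐ)`. -/
theorem nonempty_iso (h : I.zeroLocus ⊆ Set.range p.hom.base) : Nonempty (I.closedSub ≅ Y) := by
  have := H.isOpenImmersion_toClosedSub
  have : Epi H.toClosedSub.hom.base := (TopCat.epi_iff_surjective _).2 (by
    rintro ⟨z, hz⟩
    obtain ⟨y, rfl⟩ := h hz
    exact ⟨y, rfl⟩)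
  have : IsIso H.toClosedSub := SheafedSpace.IsOpenImmersion.to_iso _
  exact ⟨(asIso H.toClosedSub).symm⟩

theorem nonempty_restrict_iso (V : Opens I.zeroLocus) (h : (V : Set I.zeroLocus) =
    Set.range H.baseMap) :
    Nonempty (I.closedSub.restrict (Opens.isOpenEmbedding (X := TopCat.of I.zeroLocus) V) ≅ Y) := by
  have := H.isOpenImmersion_toClosedSub
  have : SheafedSpace.IsOpenImmersion (I.closedSub.ofRestrict
      (Opens.isOpenEmbedding (X := TopCat.of I.zeroLocus) V)) :=
    SheafedSpace.IsOpenImmersion.ofRestrict _ _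
  have e := PresheafedSpace.IsOpenImmersion.isoOfRangeEq
    (I.closedSub.ofRestrict (Opens.isOpenEmbedding (X := TopCat.of I.zeroLocus) V)).hom
    H.toClosedSub.hom ((Subtype.range_coe).trans h)
  exact ⟨SheafedSpace.isoMk e⟩

end IsOpenInClosed

end Criterion

/-! ### Functoriality of `F(A)` -/

section Functoriality

variable {A C : RingCat.{u}}

/-- The homomorphism `A_𝐚 → A_𝐛` for `D(𝐛) ⊆ D(𝐚)`. -/
def Fraction.hom {a b : Fraction A} (h : b.D ⊆ a.D) : a.ring →+* b.ring :=
  ((Fraction.D_subset_iff a b).1 h).choose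

theorem Fraction.hom_comp_map {a b : Fraction A} (h : b.D ⊆ a.D) :
    (Fraction.hom h).comp a.map = b.map := ((Fraction.D_subset_iff a b).1 h).choose_spec

theorem Fraction.comp_hom {a b : Fraction A} (h : b.D ⊆ a.D) {B : Type u} [Ring B]
    (k : b.ring →+* B) (l : a.ring →+* B) (hkl : k.comp b.map = l.comp a.map) (x : a.ring) :
    k (Fraction.hom h x) = l x := by
  have : k.comp (Fraction.hom h) = l := a.hom_ext (by rw [RingHom.comp_assoc, hom_comp_map, hkl])
  exact RingHom.congr_fun this x

theorem Fraction.hom_self {a : Fraction A} (h : a.D ⊆ a.D) (x : a.ring) :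
    Fraction.hom h x = x := Fraction.comp_hom h (RingHom.id _) (RingHom.id _) rfl x

theorem Fraction.hom_hom {a b c : Fraction A} (h : b.D ⊆ a.D) (h' : c.D ⊆ b.D) (x : a.ring) :
    Fraction.hom h' (Fraction.hom h x) = Fraction.hom (h'.trans h) x :=
  Fraction.comp_hom h _ _ (by rw [hom_comp_map, hom_comp_map]) x

variable (π : A →+* C)

/-- The map `F(C) → F(A)` induced by a homomorphism `A → C`. -/
def FullSpec.comap (T : FullSpec C) : FullSpec A :=
  haveI := (Fraction.exists_eq_ofHom T).choose_spec.choose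
  FullSpec.ofHom (B := (Fraction.exists_eq_ofHom T).choose)
    ((Fraction.exists_eq_ofHom T).choose_spec.choose_spec.choose.comp π)

variable {π}

theorem Fraction.IsPush.mem_D_iff {a : Fraction A} {b : Fraction C} {h : a.ring →+* b.ring}
    (H : IsPush π a b h) (T : FullSpec C) : T.comap π ∈ a.D ↔ T ∈ b.D := by
  have : Nontrivial (exists_eq_ofHom T).choose := (exists_eq_ofHom T).choose_spec.choose
  have e := (exists_eq_ofHom T).choose_spec.choose_spec.choose_spec
  conv_rhs => rw [e]
  rw [FullSpec.comap, mem_D_ofHom, mem_D_ofHom, H.through_iff]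

theorem Fraction.IsPush.preimage_D {a : Fraction A} {b : Fraction C} {h : a.ring →+* b.ring}
    (H : IsPush π a b h) : FullSpec.comap π ⁻¹' a.D = b.D := Set.ext H.mem_D_iff

/-- The homomorphism chosen in `FullSpec.comap` is irrelevant: membership in every `D(𝐚)` depends
only on the point, and this determines the image point. -/
theorem FullSpec.comap_ofHom {B : RingCat.{u}} [Nontrivial B] (ψ : C →+* B) :
    (FullSpec.ofHom ψ).comap π = FullSpec.ofHom (ψ.comp π) := by
  refine FullSpec.ext_of_mem_D fun a => ?_
  obtain ⟨b, h, H⟩ := a.exists_isPush π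
  rw [H.mem_D_iff, Fraction.mem_D_ofHom, Fraction.mem_D_ofHom, H.through_iff]

variable (π)

theorem FullSpec.continuous_comap : Continuous (FullSpec.comap π) := by
  refine continuous_generateFrom_iff.2 ?_
  rintro _ ⟨a, rfl⟩
  obtain ⟨b, h, H⟩ := a.exists_isPush π
  rw [H.preimage_D]
  exact b.isOpen_D

/-- Every fraction of `C` is pushed forward from `A`, so every basic open set of `F(C)` is a
preimage of a basic open set of `F(A)`. -/
theorem FullSpec.isInducing_comap (hπ : Function.Surjective π) :
    Topology.IsInducing (FullSpec.comap π) := by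
  refine ⟨le_antisymm (continuous_iff_le_induced.1 (FullSpec.continuous_comap π)) ?_⟩
  refine le_generateFrom ?_
  rintro _ ⟨b, rfl⟩
  obtain ⟨a, h, H⟩ := b.exists_isPush_of_surjective π hπ
  exact isOpen_induced_iff.2 ⟨a.D, a.isOpen_D, H.preimage_D⟩

theorem FullSpec.comap_injective (hπ : Function.Surjective π) :
    Function.Injective (FullSpec.comap π) := by
  intro S T hST
  refine FullSpec.ext_of_mem_D fun b => ?_
  obtain ⟨a, h, H⟩ := b.exists_isPush_of_surjective π hπ
  rw [← H.mem_D_iff, ← H.mem_D_iff, hST]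

/-- The continuous map `F(C) → F(A)` induced by a homomorphism `A → C`. -/
def FullSpec.comapHom : TopCat.of (FullSpec C) ⟶ TopCat.of (FullSpec A) :=
  TopCat.ofHom ⟨FullSpec.comap π, FullSpec.continuous_comap π⟩

variable {π}

/-- The center of `D(𝐛)` maps into some `D(𝐚) ⊆ U`, and every neighbourhood of the center contains
`D(𝐛)`. Hence one fraction of `A` suffices to pull sections back, and no gluing is needed. -/
theorem exists_fraction_over {U : Opens (FullSpec A)} {b : Fraction C} [Nontrivial b.ring]
    (hb : b.D ⊆ FullSpec.comap π ⁻¹' U) : ∃ a : Fraction A, a.D ⊆ U ∧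
      ∃ k : a.ring →+* b.ring, k.comp a.map = b.map.comp π := by
  obtain ⟨c, hc, hcen⟩ := b.exists_center
  obtain ⟨a, ha, haU⟩ := Fraction.exists_mem_D_subset U.2 (hb hc)
  obtain ⟨b', h, H⟩ := a.exists_isPush π
  have hbb' : b.D ⊆ b'.D := hcen _ b'.isOpen_D ((H.mem_D_iff c).1 ha)
  exact ⟨a, haU, (Fraction.hom hbb').comp h,
    by rw [RingHom.comp_assoc, H.comm, ← RingHom.comp_assoc, Fraction.hom_comp_map]⟩

theorem sections_eq_of_homs {U : Opens (FullSpec A)} (s : sections A U) {B : Type u} [Ring B]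
    (a a' : {a : Fraction A // a.D ⊆ U}) (k : a.1.ring →+* B) (k' : a'.1.ring →+* B)
    (h : k.comp a.1.map = k'.comp a'.1.map) : k (s.1 a) = k' (s.1 a') := by
  obtain ⟨m, hm⟩ := (a.1.inter_through a'.1 (k.comp a.1.map)).2 ⟨⟨k, rfl⟩, ⟨k', h.symm⟩⟩
  have hD := a.1.D_inter a'.1
  have h1 : (a.1.inter a'.1).D ⊆ a.1.D := hD ▸ Set.inter_subset_left
  have h2 : (a.1.inter a'.1).D ⊆ a'.1.D := hD ▸ Set.inter_subset_right
  let c : {a : Fraction A // a.D ⊆ U} := ⟨a.1.inter a'.1, h1.trans a.2⟩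
  have e1 := s.2 a c (Fraction.hom h1) (Fraction.hom_comp_map h1)
  have e2 := s.2 a' c (Fraction.hom h2) (Fraction.hom_comp_map h2)
  rw [← Fraction.comp_hom h1 m k hm, ← Fraction.comp_hom h2 m k' (hm.trans h), e1, e2]

theorem exists_comap_value {U : Opens (FullSpec A)} (s : sections A U) {b : Fraction C}
    (hb : b.D ⊆ FullSpec.comap π ⁻¹' U) : ∃ y : b.ring, ∀ (a : {a : Fraction A // a.D ⊆ U})
      (k : a.1.ring →+* b.ring), k.comp a.1.map = b.map.comp π → y = k (s.1 a) := by
  rcases subsingleton_or_nontrivial b.ring with h | h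
  -- When `C_𝐛 = 0` there is no center and possibly no fraction below `U` to use; the zero ring
  -- leaves only one value.
  · exact ⟨0, fun _ _ _ => Subsingleton.elim _ _⟩
  · obtain ⟨a, ha, k, hk⟩ := exists_fraction_over hb
    exact ⟨k (s.1 ⟨a, ha⟩), fun a' k' hk' =>
      sections_eq_of_homs s ⟨a, ha⟩ a' k k' (hk.trans hk'.symm)⟩

variable (π) in
/-- The value at `𝐛` of the pull back to `F(C)` of a section of `𝒪_A`. -/
def comapValue {U : Opens (FullSpec A)} (s : sections A U)
    (b : {b : Fraction C // b.D ⊆ FullSpec.comap π ⁻¹' U}) : b.1.ring :=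
  (exists_comap_value s b.2).choose

theorem comapValue_eq {U : Opens (FullSpec A)} (s : sections A U)
    (b : {b : Fraction C // b.D ⊆ FullSpec.comap π ⁻¹' U}) (a : {a : Fraction A // a.D ⊆ U})
    (k : a.1.ring →+* b.1.ring) (hk : k.comp a.1.map = b.1.map.comp π) :
    comapValue π s b = k (s.1 a) := (exists_comap_value s b.2).choose_spec a k hk

theorem eq_of_fractions_over {U : Opens (FullSpec A)}
    (b : {b : Fraction C // b.D ⊆ FullSpec.comap π ⁻¹' U}) {y y' : b.1.ring}
    (h : ∀ (a : {a : Fraction A // a.D ⊆ U}) (k : a.1.ring →+* b.1.ring),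
      k.comp a.1.map = b.1.map.comp π → y = y') : y = y' := by
  rcases subsingleton_or_nontrivial b.1.ring with hb | hb
  · exact Subsingleton.elim _ _
  · obtain ⟨a, ha, k, hk⟩ := exists_fraction_over b.2
    exact h ⟨a, ha⟩ k hk

variable (π)

/-- The pull back of sections along `F(C) → F(A)`. -/
def sectionsComap (U : Opens (FullSpec A)) :
    sections A U →+* sections C ((Opens.map (FullSpec.comapHom π)).obj U) where
  toFun s := ⟨fun b => comapValue π s b, fun b b' h hh =>
    eq_of_fractions_over (π := π) (U := U) b' fun _ _ _ => by
      rcases subsingleton_or_nontrivial b.1.ring with hb | hb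
      · have : Subsingleton b'.1.ring := by
          refine subsingleton_of_zero_eq_one ?_
          rw [← map_one h, ← map_zero h, Subsingleton.elim (0 : b.1.ring) 1]
        exact Subsingleton.elim _ _
      · obtain ⟨a, ha, k, hk⟩ := exists_fraction_over (π := π) (U := U) b.2
        exact (congrArg h (comapValue_eq s b ⟨a, ha⟩ k hk)).trans
          (comapValue_eq s b' ⟨a, ha⟩ (h.comp k)
            (by rw [RingHom.comp_assoc, hk, ← RingHom.comp_assoc, hh])).symm⟩
  map_one' := Subtype.ext (funext fun b => eq_of_fractions_over (π := π) (U := U) b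
    fun a k hk => (comapValue_eq _ b a k hk).trans (map_one k))
  map_mul' s t := Subtype.ext (funext fun b => eq_of_fractions_over (π := π) (U := U) b
    fun a k hk => (comapValue_eq _ b a k hk).trans ((map_mul k _ _).trans
      (congrArg₂ (· * ·) (comapValue_eq _ b a k hk).symm (comapValue_eq _ b a k hk).symm)))
  map_zero' := Subtype.ext (funext fun b => eq_of_fractions_over (π := π) (U := U) b
    fun a k hk => (comapValue_eq _ b a k hk).trans (map_zero k))
  map_add' s t := Subtype.ext (funext fun b => eq_of_fractions_over (π := π) (U := U) b
    fun a k hk => (comapValue_eq _ b a k hk).trans ((map_add k _ _).trans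
      (congrArg₂ (· + ·) (comapValue_eq _ b a k hk).symm (comapValue_eq _ b a k hk).symm)))

/-- The morphism of ringed spaces `F(C) → F(A)` induced by a homomorphism `A → C`. -/
def FSpecMap : FSpec C ⟶ FSpec A where
  hom :=
  { base := FullSpec.comapHom π
    c :=
    { app := fun U => RingCat.ofHom (sectionsComap π U.unop)
      naturality := fun U V i => by
        refine RingCat.hom_ext (RingHom.ext fun s => Subtype.ext (funext fun b => ?_))
        refine eq_of_fractions_over (π := π) (U := V.unop) b fun a k hk => ?_
        refine (comapValue_eq (sectionsRes A i.unop.le s) b a k hk).trans ?_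
        exact (comapValue_eq s ⟨b.1, b.2.trans fun T hT => i.unop.le hT⟩
          ⟨a.1, a.2.trans i.unop.le⟩ k hk).symm } }

end Functoriality

/-! ### The stalks of `𝒪_A` -/

section Stalks

variable {A C : RingCat.{u}}

/-- `D(𝐚)` as an open set. -/
def Fraction.opens (a : Fraction A) : Opens (FullSpec A) := ⟨a.D, a.isOpen_D⟩

/-- The section of `𝒪_A` over `D(𝐚)` given by an element of `A_𝐚`. -/
def sec (a : Fraction A) : a.ring →+* sections A a.opens where
  toFun x := ⟨fun b => Fraction.hom b.2 x, fun b c h hh =>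
    Fraction.comp_hom b.2 h (Fraction.hom c.2) (hh.trans (Fraction.hom_comp_map c.2).symm) x⟩
  map_one' := Subtype.ext (funext fun b => map_one (Fraction.hom b.2))
  map_mul' x y := Subtype.ext (funext fun b => map_mul (Fraction.hom b.2) x y)
  map_zero' := Subtype.ext (funext fun b => map_zero (Fraction.hom b.2))
  map_add' x y := Subtype.ext (funext fun b => map_add (Fraction.hom b.2) x y)

theorem sec_apply (a : Fraction A) (x : a.ring) (b : {b : Fraction A // b.D ⊆ a.opens}) :
    (sec a x).1 b = Fraction.hom b.2 x := rfl

/-- Among the fractions below `D(𝐚)` the index `𝐚` itself is initial, so a section over `D(𝐚)` is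
its component at `𝐚`. -/
theorem sectionsRes_eq_sec {U : Opens (FullSpec A)} (s : sections A U) {a : Fraction A}
    (ha : a.D ⊆ U) : sectionsRes A (show a.opens ≤ U from ha) s = sec a (s.1 ⟨a, ha⟩) :=
  Subtype.ext (funext fun b => (s.2 ⟨a, ha⟩ ⟨b.1, b.2.trans ha⟩ (Fraction.hom b.2)
    (Fraction.hom_comp_map _)).symm)

/-- The stalk `𝒪_{A,S}`. -/
def Stalk (S : FullSpec A) : RingCat.{u} := (FSpec A).presheaf.stalk S

/-- The germ at `S` of a section of `𝒪_A`. -/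
def germHom {S : FullSpec A} {U : Opens (FullSpec A)} (hS : S ∈ U) : sections A U →+* Stalk S :=
  ((FSpec A).presheaf.germ U S hS).hom

theorem germHom_res {S : FullSpec A} {U V : Opens (FullSpec A)} (h : V ≤ U) (hS : S ∈ V)
    (s : sections A U) : germHom hS (sectionsRes A h s) = germHom (h hS) s :=
  TopCat.Presheaf.germ_res_apply (FSpec A).presheaf (homOfLE h) S hS s

theorem exists_germHom_eq {S : FullSpec A} (g : Stalk S) :
    ∃ (U : Opens (FullSpec A)) (hU : S ∈ U) (s : sections A U), germHom hU s = g :=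
  TopCat.Presheaf.exists_germ_eq (FSpec A).presheaf g

theorem germHom_eq {S : FullSpec A} {U V : Opens (FullSpec A)} (hU : S ∈ U) (hV : S ∈ V)
    (s : sections A U) (t : sections A V) (e : germHom hU s = germHom hV t) :
    ∃ (W : Opens (FullSpec A)) (_ : S ∈ W) (i : W ≤ U) (j : W ≤ V),
      sectionsRes A i s = sectionsRes A j t := by
  obtain ⟨W, hW, i, j, h⟩ := TopCat.Presheaf.germ_eq (FSpec A).presheaf S hU hV s t e
  exact ⟨W, hW, i.le, j.le, h⟩

/-- The homomorphism `A_𝐚 → 𝒪_{A,S}` for `S ∈ D(𝐚)`. -/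
def germAt {S : FullSpec A} {a : Fraction A} (hS : S ∈ a.D) :
    a.ring →+* Stalk S := (germHom (U := a.opens) hS).comp (sec a)

theorem germHom_eq_germAt {S : FullSpec A} {U : Opens (FullSpec A)} (s : sections A U)
    {a : Fraction A} (ha : a.D ⊆ U) (hS : S ∈ a.D) :
    germHom (ha hS) s = germAt hS (s.1 ⟨a, ha⟩) := by
  rw [germAt, RingHom.comp_apply, ← sectionsRes_eq_sec s ha]
  exact (germHom_res (show a.opens ≤ U from ha) hS s).symm

theorem germAt_hom {S : FullSpec A} {a b : Fraction A} (h : b.D ⊆ a.D) (hS : S ∈ b.D)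
    (x : a.ring) : germAt hS (Fraction.hom h x) = germAt (h hS) x :=
  (germHom_eq_germAt (sec a x) h hS).symm

theorem FullSpec.mem_D_nil (S : FullSpec A) : S ∈ (Fraction.nil A).D :=
  (Fraction.D_nil A).superset (Set.mem_univ S)

theorem germAt_comp_map {S : FullSpec A} {a : Fraction A} (hS : S ∈ a.D) :
    (germAt hS).comp a.map = germAt S.mem_D_nil := by
  have h : a.D ⊆ (Fraction.nil A).D := by rw [Fraction.D_nil]; exact Set.subset_univ _
  refine RingHom.ext fun x => ?_
  exact (congrArg (germAt hS) (RingHom.congr_fun (Fraction.hom_comp_map h) x).symm).trans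
    (germAt_hom h hS x)

theorem exists_germAt_eq {S : FullSpec A} (g : Stalk S) :
    ∃ (a : Fraction A) (hS : S ∈ a.D) (x : a.ring), germAt hS x = g := by
  obtain ⟨U, hU, s, rfl⟩ := exists_germHom_eq g
  obtain ⟨a, ha, haU⟩ := Fraction.exists_mem_D_subset U.2 hU
  exact ⟨a, ha, _, (germHom_eq_germAt s haU ha).symm⟩

theorem germAt_eq_zero_iff {S : FullSpec A} {a : Fraction A} (hS : S ∈ a.D) (x : a.ring) :
    germAt hS x = 0 ↔ ∃ (b : Fraction A) (h : b.D ⊆ a.D), S ∈ b.D ∧ Fraction.hom h x = 0 := by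
  constructor
  · intro h
    obtain ⟨W, hW, i, j, e⟩ := germHom_eq (U := a.opens) (V := a.opens) hS hS (sec a x) 0
      (h.trans (map_zero _).symm)
    obtain ⟨b, hb, hbW⟩ := Fraction.exists_mem_D_subset W.2 hW
    exact ⟨b, hbW.trans i, hb, congrArg (fun t : sections A W => t.1 ⟨b, hbW⟩) e⟩
  · rintro ⟨b, h, hb, e⟩
    rw [← germAt_hom h hb x, e, map_zero]

theorem germAt_eq_iff {S : FullSpec A} {a : Fraction A} (hS : S ∈ a.D) (x y : a.ring) :
    germAt hS x = germAt hS y ↔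
      ∃ (b : Fraction A) (h : b.D ⊆ a.D), S ∈ b.D ∧ Fraction.hom h x = Fraction.hom h y := by
  rw [← sub_eq_zero, ← map_sub, germAt_eq_zero_iff]
  simp only [map_sub, sub_eq_zero]

/-- An equality `0 = 1` of germs would already hold in some `A_𝐛` with `S ∈ D(𝐛)`, but such a ring
maps to a nonzero ring. -/
instance (S : FullSpec A) : Nontrivial (Stalk S) := by
  have h := S.mem_D_nil
  refine ⟨0, 1, fun e => ?_⟩
  rw [← map_one (germAt h), ← map_zero (germAt h), germAt_eq_iff] at e
  obtain ⟨b, hb, hS, e⟩ := e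
  have := Fraction.nontrivial_of_mem_D hS
  rw [map_one, map_zero] at e
  exact zero_ne_one e

/-- An inverse germ and both of its relations live over one smaller fraction containing `S`. There
`x` becomes a unit, so the smaller basic set lies inside `D(𝐚,x)`. -/
theorem isUnit_germAt_iff {S : FullSpec A} {a : Fraction A} (hS : S ∈ a.D) (x : a.ring) :
    IsUnit (germAt hS x) ↔ S ∈ (a.snoc x).D := by
  constructor
  · rintro ⟨u, hu⟩
    obtain ⟨b, hb, y, hy⟩ := exists_germAt_eq (u⁻¹.1)
    have hD := a.D_inter b
    have h1 : (a.inter b).D ⊆ a.D := hD ▸ Set.inter_subset_left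
    have h2 : (a.inter b).D ⊆ b.D := hD ▸ Set.inter_subset_right
    have hc : S ∈ (a.inter b).D := hD ▸ ⟨hS, hb⟩
    have e1 : germAt hc (Fraction.hom h1 x * Fraction.hom h2 y) = germAt hc 1 := by
      rw [map_mul, germAt_hom, germAt_hom, ← hu, hy, u.mul_inv, map_one]
    have e2 : germAt hc (Fraction.hom h2 y * Fraction.hom h1 x) = germAt hc 1 := by
      rw [map_mul, germAt_hom, germAt_hom, ← hu, hy, u.inv_mul, map_one]
    obtain ⟨d, hd, hSd, e1⟩ := (germAt_eq_iff hc _ _).1 e1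
    obtain ⟨d', hd', hSd', e2⟩ := (germAt_eq_iff hc _ _).1 e2
    have h3 : (d.inter d').D ⊆ d.D := d.D_inter d' ▸ Set.inter_subset_left
    have h4 : (d.inter d').D ⊆ d'.D := d.D_inter d' ▸ Set.inter_subset_right
    have h5 : S ∈ (d.inter d').D := d.D_inter d' ▸ ⟨hSd, hSd'⟩
    have e1 := congrArg (Fraction.hom h3) e1
    have e2 := congrArg (Fraction.hom h4) e2
    simp only [map_mul, map_one, Fraction.hom_hom] at e1 e2
    have hu : IsUnit (Fraction.hom (h3.trans (hd.trans h1)) x) := ⟨⟨_, _, e1, e2⟩, rfl⟩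
    have := (a.through_snoc x _).2 hu
    rw [Fraction.hom_comp_map] at this
    exact (Fraction.D_subset_iff_through _ _).2 this h5
  · intro h
    rw [← germAt_hom (a.D_snoc_subset x) h x]
    have : Fraction.hom (a.D_snoc_subset x) x = a.snocMap x x :=
      Fraction.comp_hom (a.D_snoc_subset x) (RingHom.id _) (a.snocMap x) rfl x
    rw [this]
    exact (a.isUnit_snocMap x).map (germAt h)

theorem stalkHom_germAt {π : A →+* C} {a : Fraction A} {b : Fraction C} {h : a.ring →+* b.ring}
    (H : Fraction.IsPush π a b h) {T : FullSpec C} (ha : T.comap π ∈ a.D) (hb : T ∈ b.D)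
    (x : a.ring) : stalkHom (FSpecMap π) T (germAt (S := T.comap π) ha x) = germAt hb (h x) := by
  refine (stalkHom_germ (FSpecMap π) T a.opens ha (sec a x)).trans ?_
  have hba : b.D ⊆ FullSpec.comap π ⁻¹' a.opens := H.preimage_D.superset
  refine (germHom_eq_germAt (sectionsComap π a.opens (sec a x)) hba hb).trans ?_
  refine congrArg (germAt hb) ?_
  refine (comapValue_eq (sec a x) ⟨b, hba⟩ ⟨a, Set.Subset.rfl⟩ h H.comm).trans ?_
  rw [sec_apply]
  exact congrArg h (Fraction.hom_self _ x)

end Stalks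

/-! ### The closed subspace of `F(A)` defined by a two-sided ideal of `A` -/

theorem IdealSheaf.mem_stalk {X : SheafedSpace RingCat.{u}} (I : IdealSheaf X) {x : X}
    {g : X.presheaf.stalk x} : g ∈ I.stalk x ↔ ∃ (U : Opens X) (hx : x ∈ U)
      (s : X.presheaf.obj (op U)), s ∈ I.ideal U ∧ X.presheaf.germ U x hx s = g :=
  TwoSidedIdeal.mem_mk' _ _ _ _ _ _ _

/-! ### Jacobson radical and reflection of units -/

/-- The radical is described by left ideals and gives only a left inverse `y`. But `y - 1` is again
in the radical, so `y` has a left inverse as well, which must be `x`. -/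
theorem isUnit_of_sub_one_mem_jacobson {R : Type u} [Ring R] {x : R}
    (h : x - 1 ∈ Ring.jacobson R) : IsUnit x := by
  have left : ∀ x : R, x - 1 ∈ Ring.jacobson R → ∃ y, y * x = 1 ∧ y - 1 ∈ Ring.jacobson R := by
    intro x h
    have h' := h
    rw [← Ideal.jacobson_bot] at h
    obtain ⟨y, hy⟩ := Ideal.mem_jacobson_iff.1 h 1
    rw [Ideal.mem_bot, mul_one, mul_sub, mul_one, sub_add_cancel, sub_eq_zero] at hy
    refine ⟨y, hy, ?_⟩
    have e : y - 1 = -(y * (x - 1)) := by rw [mul_sub, hy, mul_one, neg_sub]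
    rw [e]
    exact neg_mem (Ideal.mul_mem_left _ _ h')
  obtain ⟨y, hy, hy1⟩ := left x h
  obtain ⟨z, hz, -⟩ := left y hy1
  have : z = x := left_inv_eq_right_inv hz hy
  exact ⟨⟨x, y, this ▸ hz, hy⟩, rfl⟩

/-- A lift `y` of the inverse makes `x * y` and `y * x` congruent to `1` modulo the radical, so both
products are units. -/
theorem isUnit_of_isUnit_of_ker_le_jacobson {R B : Type u} [Ring R] [Ring B] (f : R →+* B)
    (hf : Function.Surjective f) (h : ∀ x, f x = 0 → x ∈ Ring.jacobson R) {x : R}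
    (hx : IsUnit (f x)) : IsUnit x := by
  obtain ⟨u, hu⟩ := hx
  obtain ⟨y, hy⟩ := hf (u⁻¹ : Bˣ)
  have h1 : IsUnit (x * y) := isUnit_of_sub_one_mem_jacobson (h _ (by
    rw [map_sub, map_mul, hy, ← hu, u.mul_inv, map_one, sub_self]))
  have h2 : IsUnit (y * x) := isUnit_of_sub_one_mem_jacobson (h _ (by
    rw [map_sub, map_mul, hy, ← hu, u.inv_mul, map_one, sub_self]))
  obtain ⟨v, hv⟩ := h1
  obtain ⟨w, hw⟩ := h2
  have e1 : x * (y * v⁻¹.1) = 1 := by rw [← mul_assoc, ← hv, v.mul_inv]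
  have e2 : (w⁻¹.1 * y) * x = 1 := by rw [mul_assoc, ← hw, w.inv_mul]
  exact ⟨⟨x, y * v⁻¹.1, e1, by rwa [← left_inv_eq_right_inv e2 e1]⟩, rfl⟩

/-- For `x` in the kernel, each `y * x + 1` maps to `1` and is therefore a unit, which is the
criterion for the radical. -/
theorem ker_le_jacobson_of_isUnit {R B : Type u} [Ring R] [Ring B] (f : R →+* B)
    (h : ∀ x, IsUnit (f x) → IsUnit x) {x : R} (hx : f x = 0) : x ∈ Ring.jacobson R := by
  rw [← Ideal.jacobson_bot, Ideal.mem_jacobson_iff]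
  intro y
  have : IsUnit (y * x + 1) := h _ (by rw [map_add, map_mul, hx, mul_zero, zero_add, map_one]; simp)
  obtain ⟨u, hu⟩ := this
  refine ⟨u⁻¹.1, Ideal.mem_bot.2 ?_⟩
  have e : u⁻¹.1 * (y * x + 1) = 1 := by rw [← hu, u.inv_mul]
  rw [mul_add, mul_one, ← mul_assoc] at e
  rw [e, sub_self]

section Affine

variable {A C : RingCat.{u}} {π : A →+* C}

/-- The stalk of the sheaf of ideals on `F(A)` generated by a two-sided ideal of `A`. -/
def genStalk (I : TwoSidedIdeal A) (S : FullSpec A) : TwoSidedIdeal (Stalk S) :=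
  (idealSheafOf A I).stalk S

theorem mem_genStalk {I : TwoSidedIdeal A} {S : FullSpec A} {g : Stalk S} :
    g ∈ genStalk I S ↔ ∃ (U : Opens (FullSpec A)) (hS : S ∈ U) (s : sections A U),
      s ∈ generatedIdeal A I U ∧ germHom hS s = g :=
  IdealSheaf.mem_stalk (idealSheafOf A I)

theorem Fraction.hom_mem_span (I : TwoSidedIdeal A) {a b : Fraction A} (h : b.D ⊆ a.D)
    {x : a.ring} (hx : x ∈ TwoSidedIdeal.span (a.map '' (I : Set A))) :
    Fraction.hom h x ∈ TwoSidedIdeal.span (b.map '' (I : Set A)) := by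
  have : TwoSidedIdeal.span (a.map '' (I : Set A)) ≤
      (TwoSidedIdeal.span (b.map '' (I : Set A))).comap (Fraction.hom h) :=
    TwoSidedIdeal.span_le.2 (by
      rintro _ ⟨y, hy, rfl⟩
      refine (TwoSidedIdeal.mem_comap _).2 (TwoSidedIdeal.subset_span ⟨y, hy, ?_⟩)
      exact (RingHom.congr_fun (Fraction.hom_comp_map h) y).symm)
  exact (TwoSidedIdeal.mem_comap _).1 (this hx)

theorem sec_mem_generatedIdeal (I : TwoSidedIdeal A) {a : Fraction A} {x : a.ring}
    (hx : x ∈ TwoSidedIdeal.span (a.map '' (I : Set A))) :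
    sec a x ∈ generatedIdeal A I a.opens :=
  mem_generatedIdeal.2 fun b => Fraction.hom_mem_span I b.2 hx

variable (π) in
/-- The map `𝒪_{A,S} → 𝒪_{C,T}` for `T ∈ F(C)` with image `S ∈ F(A)`. -/
def comapStalk (T : FullSpec C) : Stalk (T.comap π) →+* Stalk T := stalkHom (FSpecMap π) T

theorem comapStalk_germAt {a : Fraction A} {b : Fraction C} {h : a.ring →+* b.ring}
    (H : Fraction.IsPush π a b h) {T : FullSpec C} (ha : T.comap π ∈ a.D) (hb : T ∈ b.D)
    (x : a.ring) : comapStalk π T (germAt ha x) = germAt hb (h x) :=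
  stalkHom_germAt H ha hb x

theorem comapStalk_surjective (hπ : Function.Surjective π) (T : FullSpec C) :
    Function.Surjective (comapStalk π T) := by
  intro g
  obtain ⟨b, hb, y, rfl⟩ := exists_germAt_eq g
  obtain ⟨a, h, H⟩ := b.exists_isPush_of_surjective π hπ
  obtain ⟨x, rfl⟩ := H.surjective hπ y
  exact ⟨germAt ((H.mem_D_iff T).2 hb) x, comapStalk_germAt H _ hb x⟩

/-- A germ dies in `𝒪_{C,T}` only if its representative dies over some smaller fraction of `C`. That
fraction comes from `A`, so after shrinking in `F(A)` the representative lies in a kernel computed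
by `IsPush.ker_eq`. -/
theorem comapStalk_eq_zero_iff (hπ : Function.Surjective π) (T : FullSpec C)
    (g : Stalk (T.comap π)) :
    comapStalk π T g = 0 ↔ g ∈ genStalk (TwoSidedIdeal.ker π) (T.comap π) := by
  constructor
  · intro hg
    obtain ⟨a, ha, x, rfl⟩ := exists_germAt_eq g
    obtain ⟨b, h, H⟩ := a.exists_isPush π
    have hb := (H.mem_D_iff T).1 ha
    rw [comapStalk_germAt H ha hb, germAt_eq_zero_iff] at hg
    obtain ⟨b', hb', hT, e⟩ := hg
    obtain ⟨a', h', H'⟩ := b'.exists_isPush_of_surjective π hπ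
    obtain ⟨b'', h'', H''⟩ := (a.inter a').exists_isPush π
    have hD := a.D_inter a'
    have h1 : (a.inter a').D ⊆ a.D := hD ▸ Set.inter_subset_left
    have h2 : (a.inter a').D ⊆ a'.D := hD ▸ Set.inter_subset_right
    have h3 : b''.D ⊆ b'.D := by
      rw [← H''.preimage_D, ← H'.preimage_D]
      exact Set.preimage_mono h2
    have hT' : T.comap π ∈ (a.inter a').D := hD ▸ ⟨ha, (H'.mem_D_iff T).2 hT⟩
    have key : h''.comp (Fraction.hom h1) =
        (Fraction.hom h3).comp ((Fraction.hom hb').comp h) := a.hom_ext (by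
      simp only [RingHom.comp_assoc, Fraction.hom_comp_map, H.comm, H''.comm]
      rw [← Fraction.hom_comp_map h3, ← Fraction.hom_comp_map hb']
      rfl)
    have hz : h'' (Fraction.hom h1 x) = 0 :=
      (RingHom.congr_fun key x).trans ((congrArg (Fraction.hom h3) e).trans (map_zero _))
    rw [H''.ker_eq hπ] at hz
    exact mem_genStalk.2 ⟨(a.inter a').opens, hT', sec _ (Fraction.hom h1 x),
      sec_mem_generatedIdeal _ hz, germAt_hom h1 hT' x⟩
  · intro hg
    obtain ⟨U, hU, s, hs, rfl⟩ := mem_genStalk.1 hg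
    obtain ⟨a, ha, haU⟩ := Fraction.exists_mem_D_subset U.2 hU
    obtain ⟨b, h, H⟩ := a.exists_isPush π
    have hb := (H.mem_D_iff T).1 ha
    rw [germHom_eq_germAt s haU ha, comapStalk_germAt H ha hb,
      (H.ker_eq hπ _).2 (mem_generatedIdeal.1 hs ⟨a, haU⟩), map_zero]

/-- Invertibility of a germ is membership in `D(𝐚,x)`, whose preimage in `F(C)` is the basic set of
the pushed-forward fraction. -/
theorem isUnit_of_isUnit_comapStalk (T : FullSpec C) {g : Stalk (T.comap π)}
    (hg : IsUnit (comapStalk π T g)) : IsUnit g := by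
  obtain ⟨a, ha, x, rfl⟩ := exists_germAt_eq g
  obtain ⟨b, h, H⟩ := a.exists_isPush π
  have hb := (H.mem_D_iff T).1 ha
  rw [comapStalk_germAt H ha hb, isUnit_germAt_iff] at hg
  rw [isUnit_germAt_iff]
  obtain ⟨h', H'⟩ := H.snoc x
  exact (H'.mem_D_iff T).2 hg

/-- Reducing the stalk modulo an ideal in its radical reflects units, so `A → 𝒪_S/ℐ_S` represents
`S` itself. As it kills `ker π`, it descends to `C` and defines the required point of `F(C)`. -/
theorem mem_range_comap_of_le_jacobson (hπ : Function.Surjective π) (S : FullSpec A)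
    (hS : ∀ g ∈ genStalk (TwoSidedIdeal.ker π) S, g ∈ Ring.jacobson (Stalk S)) :
    ∃ T : FullSpec C, T.comap π = S := by
  let J := genStalk (TwoSidedIdeal.ker π) S
  let Q : RingCat.{u} := RingCat.of J.ringCon.Quotient
  let q : Stalk S →+* Q := J.ringCon.mk'
  have hq : ∀ y, q y = 0 ↔ y ∈ J := fun y => by
    have := J.rel_iff y 0
    rw [sub_zero] at this
    rw [← this, ← map_zero q]
    exact RingCon.eq _
  have hqs : Function.Surjective q := RingCon.mk'_surjective _
  have hu : ∀ {y}, IsUnit (q y) → IsUnit y := fun h =>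
    isUnit_of_isUnit_of_ker_le_jacobson q hqs (fun y hy => hS y ((hq y).1 hy)) h
  have hQ : Nontrivial Q := by
    refine ⟨0, 1, fun e => ?_⟩
    have h0 : IsUnit (0 : Stalk S) := hu (by rw [map_zero, e]; exact isUnit_one)
    exact not_isUnit_zero h0
  let χ : A →+* Q := q.comp (germAt (a := Fraction.nil A) S.mem_D_nil)
  have hχ : RingHom.ker π ≤ RingHom.ker χ := fun y hy => by
    refine (hq _).2 (mem_genStalk.2 ⟨(Fraction.nil A).opens, S.mem_D_nil, sec (Fraction.nil A) y,
      sec_mem_generatedIdeal _ (TwoSidedIdeal.subset_span ⟨y, ?_, rfl⟩), rfl⟩)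
    exact (TwoSidedIdeal.mem_ker π).2 hy
  obtain ⟨ψ, hψ⟩ : ∃ ψ : C →+* Q, ψ.comp π = χ := ⟨_, π.liftOfSurjective_comp hπ ⟨χ, hχ⟩⟩
  refine ⟨FullSpec.ofHom ψ, ?_⟩
  rw [FullSpec.comap_ofHom, hψ]
  have key : ∀ (a : Fraction A) (ha : S ∈ a.D), (q.comp (germAt ha)).comp a.map = χ :=
    fun a ha => congrArg q.comp (germAt_comp_map ha)
  refine FullSpec.ext_of_mem_D fun a => ?_
  rw [Fraction.mem_D_ofHom]
  refine ⟨fun h => ?_, fun h => ⟨_, key a h⟩⟩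
  -- Entry by entry: once `S ∈ D(𝐚)`, factoring through `A_(𝐚,x)` says that the germ of `x` is a
  -- unit modulo `ℐ_S`, hence a unit.
  induction a using Fraction.induction with
  | h0 => exact S.mem_D_nil
  | h1 a x ih =>
    have ha : S ∈ a.D := ih (by
      obtain ⟨k, hk⟩ := h
      exact ⟨k.comp (a.snocMap x), hk⟩)
    rw [← key a ha, a.through_snoc] at h
    exact (isUnit_germAt_iff ha x).1 (hu h)

variable (π) in
theorem range_comap_eq (hπ : Function.Surjective π) : Set.range (FullSpec.comap π) =
    (idealSheafOf A (TwoSidedIdeal.ker π)).zeroLocus := by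
  ext S
  constructor
  · rintro ⟨T, rfl⟩ g hg
    exact ker_le_jacobson_of_isUnit (comapStalk π T) (fun g => isUnit_of_isUnit_comapStalk T)
      ((comapStalk_eq_zero_iff hπ T g).2 hg)
  · exact fun hS => mem_range_comap_of_le_jacobson hπ S hS

variable (π) in
theorem isOpenInClosed_FSpecMap (hπ : Function.Surjective π) :
    IsOpenInClosed (FSpecMap π) (idealSheafOf A (TwoSidedIdeal.ker π)) where
  injective := FullSpec.comap_injective π hπ
  inducing := FullSpec.isInducing_comap π hπ
  exists_range_eq := ⟨Set.univ, isOpen_univ, (range_comap_eq π hπ).trans (Set.univ_inter _).symm⟩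
  surjective := comapStalk_surjective hπ
  ker := comapStalk_eq_zero_iff hπ

/-- The quotient homomorphism `A → A / I`. -/
def quotMk (A : RingCat.{u}) (I : TwoSidedIdeal A) : A →+* quotRing A I := I.ringCon.mk'

theorem quotMk_surjective (A : RingCat.{u}) (I : TwoSidedIdeal A) :
    Function.Surjective (quotMk A I) := RingCon.mk'_surjective _

theorem ker_quotMk (A : RingCat.{u}) (I : TwoSidedIdeal A) :
    TwoSidedIdeal.ker (quotMk A I) = I := by
  refine TwoSidedIdeal.ext fun x => ?_
  have := I.rel_iff x 0
  rw [sub_zero] at this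
  rw [TwoSidedIdeal.mem_ker, ← this, ← map_zero (quotMk A I)]
  exact RingCon.eq _

/-- For the sheaf of ideals `ℐ` generated by a two-sided ideal `I` of `A`, the ringed space
`(Z(ℐ), 𝒪_A / ℐ)` is isomorphic to `F(A / I)`. -/
theorem nonempty_closedSub_idealSheafOf_iso (A : RingCat.{u}) (I : TwoSidedIdeal A) :
    Nonempty ((idealSheafOf A I).closedSub ≅ FSpec (quotRing A I)) := by
  have H := isOpenInClosed_FSpecMap (quotMk A I)
    (quotMk_surjective A I)
  have hr := range_comap_eq (quotMk A I) (quotMk_surjective A I)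
  rw [ker_quotMk] at H hr
  exact H.nonempty_iso hr.superset

end Affine

/-! ### Open immersions -/

section OpenImmersion

variable {X Y Z : SheafedSpace RingCat.{u}}

theorem stalkHom_comp (q : Z ⟶ Y) (j : Y ⟶ X) (z : Z)
    (g : X.presheaf.stalk (j.hom.base (q.hom.base z))) :
    stalkHom (q ≫ j) z g = stalkHom q z (stalkHom j (q.hom.base z) g) :=
  ConcreteCategory.congr_hom (PresheafedSpace.stalkMap.comp q.hom j.hom z) g

theorem stalkHom_bijective (j : Y ⟶ X) [SheafedSpace.IsOpenImmersion j] (y : Y) :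
    Function.Bijective (stalkHom j y) :=
  (ConcreteCategory.isIso_iff_bijective (j.hom.stalkMap y)).1 inferInstance

theorem mem_jacobson_iff_of_bijective {R B : Type u} [Ring R] [Ring B] (f : R →+* B)
    (hf : Function.Bijective f) (x : R) : f x ∈ Ring.jacobson B ↔ x ∈ Ring.jacobson R := by
  constructor
  · intro h
    rw [← Ideal.jacobson_bot, Ideal.mem_jacobson_iff] at h ⊢
    intro y
    obtain ⟨z, hz⟩ := h (f y)
    obtain ⟨w, rfl⟩ := hf.2 z
    refine ⟨w, Ideal.mem_bot.2 (hf.1 ?_)⟩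
    rw [map_zero, ← Ideal.mem_bot.1 hz]
    simp only [map_sub, map_add, map_mul, map_one]
  · intro h
    rw [← Ideal.jacobson_bot, Ideal.mem_jacobson_iff] at h ⊢
    intro y
    obtain ⟨w, rfl⟩ := hf.2 y
    obtain ⟨z, hz⟩ := h w
    refine ⟨f z, Ideal.mem_bot.2 ?_⟩
    rw [← map_zero f, ← Ideal.mem_bot.1 hz]
    simp only [map_sub, map_add, map_mul, map_one]

/-- The sheaf of ideals `𝒥` on `Y` is the restriction of `ℐ` along the open immersion `j`. -/
def IdealSheaf.IsRestriction (j : Y ⟶ X) (J : IdealSheaf Y) (I : IdealSheaf X) : Prop :=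
  ∀ (W : Opens X) (_ : (W : Set X) ⊆ Set.range j.hom.base) (s : X.presheaf.obj (op W)),
    s ∈ I.ideal W ↔ sectionHom j W s ∈ J.ideal ((Opens.map j.hom.base).obj W)

namespace IdealSheaf.IsRestriction

variable {j : Y ⟶ X} [hj : SheafedSpace.IsOpenImmersion j] {J : IdealSheaf Y} {I : IdealSheaf X}
  (h : IsRestriction j J I)
include h

theorem mem_stalk_iff (y : Y) (g : X.presheaf.stalk (j.hom.base y)) :
    stalkHom j y g ∈ J.stalk y ↔ g ∈ I.stalk (j.hom.base y) := by
  constructor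
  · intro hg
    obtain ⟨V, hV, r, hr, e⟩ := J.mem_stalk.1 hg
    obtain ⟨U, hU, s, rfl⟩ := TopCat.Presheaf.exists_germ_eq _ g
    rw [stalkHom_germ] at e
    obtain ⟨W', hW', i, i', e⟩ := TopCat.Presheaf.germ_eq Y.presheaf y _ _ _ _ e
    -- `IsRestriction` compares sections only over open sets inside the range of `j`, so the
    -- representative is restricted to an image under `j`.
    let W : Opens X := ⟨j.hom.base '' W', hj.base_open.isOpenMap _ W'.2⟩
    have hWU : W ≤ U := by
      rintro _ ⟨w, hw, rfl⟩
      exact i'.le hw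
    have hWW' : (Opens.map j.hom.base).obj W ≤ W' := by
      rintro w ⟨w', hw', e⟩
      exact hj.base_open.injective e ▸ hw'
    refine I.mem_stalk.2 ⟨W, ⟨y, hW', rfl⟩, X.presheaf.map (homOfLE hWU).op s, ?_,
      TopCat.Presheaf.germ_res_apply X.presheaf (homOfLE hWU) _ _ s⟩
    rw [h W (Set.image_subset_range _ _), sectionHom_res]
    have : Y.presheaf.map ((Opens.map j.hom.base).map (homOfLE hWU)).op (sectionHom j U s) =
        Y.presheaf.map (homOfLE hWW').op (Y.presheaf.map i'.op (sectionHom j U s)) :=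
      ConcreteCategory.congr_hom (Y.presheaf.map_comp i'.op (homOfLE hWW').op) _
    rw [this, ← e]
    exact J.map_mem _ _ (J.map_mem _ _ hr)
  · intro hg
    obtain ⟨U, hU, s, hs, rfl⟩ := I.mem_stalk.1 hg
    let W : Opens X := U ⊓ ⟨Set.range j.hom.base, hj.base_open.isOpen_range⟩
    have hW : j.hom.base y ∈ W := ⟨hU, y, rfl⟩
    have hs' := I.map_mem (homOfLE (inf_le_left : W ≤ U)) s hs
    rw [h W (fun _ hx => hx.2)] at hs'
    refine J.mem_stalk.2 ⟨_, hW, _, hs', ?_⟩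
    rw [← stalkHom_germ j y W hW]
    exact congrArg (stalkHom j y)
      (TopCat.Presheaf.germ_res_apply X.presheaf (homOfLE (inf_le_left : W ≤ U)) _ hW s)

theorem mem_zeroLocus_iff (y : Y) : j.hom.base y ∈ I.zeroLocus ↔ y ∈ J.zeroLocus := by
  constructor
  · intro hy g hg
    obtain ⟨g', rfl⟩ := (stalkHom_bijective j y).2 g
    exact (mem_jacobson_iff_of_bijective _ (stalkHom_bijective j y) _).2
      (hy _ ((h.mem_stalk_iff y g').1 hg))
  · intro hy g hg
    exact (mem_jacobson_iff_of_bijective _ (stalkHom_bijective j y) _).1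
      (hy _ ((h.mem_stalk_iff y g).2 hg))

theorem range_comp_eq (q : Z ⟶ Y) (W : Set Y) (hW : Set.range q.hom.base = W ∩ J.zeroLocus) :
    Set.range (q ≫ j).hom.base = j.hom.base '' W ∩ I.zeroLocus := by
  ext x
  constructor
  · rintro ⟨z, rfl⟩
    have := hW.subset ⟨z, rfl⟩
    exact ⟨⟨_, this.1, rfl⟩, (h.mem_zeroLocus_iff _).2 this.2⟩
  · rintro ⟨⟨y, hy, rfl⟩, hx⟩
    obtain ⟨z, hz⟩ := hW.superset ⟨hy, (h.mem_zeroLocus_iff y).1 hx⟩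
    exact ⟨z, congrArg j.hom.base hz⟩

theorem isOpenInClosed_comp {q : Z ⟶ Y} (H : IsOpenInClosed q J) : IsOpenInClosed (q ≫ j) I where
  injective := hj.base_open.injective.comp H.injective
  inducing := hj.base_open.isInducing.comp H.inducing
  exists_range_eq := by
    obtain ⟨W, hW, hr⟩ := H.exists_range_eq
    exact ⟨_, hj.base_open.isOpenMap _ hW, h.range_comp_eq q W hr⟩
  surjective z := by
    have e : ⇑(stalkHom (q ≫ j) z) = stalkHom q z ∘ stalkHom j (q.hom.base z) :=
      funext (stalkHom_comp q j z)
    rw [e]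
    exact (H.surjective z).comp (stalkHom_bijective j _).2
  ker z g := (Eq.congr_left (stalkHom_comp q j z g)).trans
    ((H.ker z _).trans (h.mem_stalk_iff (q.hom.base z) g))

end IdealSheaf.IsRestriction

end OpenImmersion

/-! ### Charts -/

section Charts

variable {X : SheafedSpace RingCat.{u}} {U : Opens X} {A : RingCat.{u}}
  (e : X.restrict U.isOpenEmbedding ≅ FSpec A)

/-- The open immersion `F(A) → X` of a chart. -/
def chartMap : FSpec A ⟶ X := e.inv ≫ X.ofRestrict U.isOpenEmbedding

instance : SheafedSpace.IsOpenImmersion (chartMap e) := by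
  have : SheafedSpace.IsOpenImmersion e.inv := inferInstance
  have : SheafedSpace.IsOpenImmersion (X.ofRestrict U.isOpenEmbedding) := inferInstance
  unfold chartMap
  infer_instance

theorem chart_inv_hom (S : FullSpec A) : e.hom.hom.base (e.inv.hom.base S) = S :=
  ConcreteCategory.congr_hom (congrArg (fun f : FSpec A ⟶ FSpec A => f.hom.base) e.inv_hom_id) S

theorem chart_hom_inv (x : X.restrict U.isOpenEmbedding) :
    e.inv.hom.base (e.hom.hom.base x) = x :=
  ConcreteCategory.congr_hom (congrArg (fun f : X.restrict U.isOpenEmbedding ⟶ _ => f.hom.base)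
    e.hom_inv_id) x

theorem range_chartMap : Set.range (chartMap e).hom.base = U := by
  ext x
  constructor
  · rintro ⟨S, rfl⟩
    exact (e.inv.hom.base S).2
  · intro hx
    exact ⟨e.hom.hom.base ⟨x, hx⟩, congrArg Subtype.val (chart_hom_inv e ⟨x, hx⟩)⟩

theorem chartOpen_eq (V : Opens (FullSpec A)) :
    (IdealSheaf.chartOpen e V : Set X) = (chartMap e).hom.base '' V.carrier := by
  ext x
  constructor
  · rintro ⟨u, hu, rfl⟩
    exact ⟨_, hu, congrArg Subtype.val (chart_hom_inv e u)⟩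
  · rintro ⟨S, hS, rfl⟩
    refine ⟨e.inv.hom.base S, ?_, rfl⟩
    exact Eq.mpr (congrArg (fun T : FullSpec A => T ∈ V) (chart_inv_hom e S)) hS

theorem chartOpen_mono {V W : Opens (FullSpec A)} (h : W ≤ V) :
    IdealSheaf.chartOpen e W ≤ IdealSheaf.chartOpen e V := by
  rintro _ ⟨u, hu, rfl⟩
  exact ⟨u, h hu, rfl⟩

theorem chartRing_res {V W : Opens (FullSpec A)} (h : W ≤ V) (r : sections A V) :
    IdealSheaf.chartRing e W (sectionsRes A h r) =
      X.presheaf.map (homOfLE (chartOpen_mono e h)).op (IdealSheaf.chartRing e V r) :=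
  ConcreteCategory.congr_hom (e.hom.hom.c.naturality (homOfLE h).op) r

theorem chartRing_bijective (V : Opens (FullSpec A)) :
    Function.Bijective (IdealSheaf.chartRing e V) := by
  have : IsIso e.hom.hom.c := PresheafedSpace.c_isIso_of_iso e.hom.hom
  exact (ConcreteCategory.isIso_iff_bijective (e.hom.hom.c.app (op V))).1
    ((NatTrans.isIso_iff_isIso_app _).1 this _)

theorem chartRing_sectionHom (W : Opens X)
    (i : IdealSheaf.chartOpen e ((Opens.map (chartMap e).hom.base).obj W) ⟶ W)
    (s : X.presheaf.obj (op W)) :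
    IdealSheaf.chartRing e ((Opens.map (chartMap e).hom.base).obj W) (sectionHom (chartMap e) W s) =
      X.presheaf.map i.op s := by
  have h := SheafedSpace.congr_hom_app e.hom_inv_id
    (op ((Opens.map (X.ofRestrict U.isOpenEmbedding).hom.base).obj W))
  have h' := ConcreteCategory.congr_hom h ((X.ofRestrict U.isOpenEmbedding).hom.c.app (op W) s)
  -- What remains of `e.hom_inv_id` is a composite of restrictions, and restriction maps between
  -- fixed open sets are unique.
  have key : ∀ {V V' : Opens X} (k : op W ⟶ op V) (m : op V ⟶ op V') (n : op W ⟶ op V'),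
      X.presheaf.map m (X.presheaf.map k s) = X.presheaf.map n s := fun k m n =>
    (ConcreteCategory.congr_hom (X.presheaf.map_comp k m) s).symm.trans
      (congrArg (fun l => X.presheaf.map l s) (Subsingleton.elim _ _))
  exact h'.trans (key _ _ _)

/-- Every open subset of `U` equals the `chartOpen` of its preimage in `F(A)`, though not
definitionally; restrictions in both directions bridge the gap. -/
theorem isRestriction_chartMap (J : IdealSheaf (FSpec A)) (I : IdealSheaf X)
    (h : ∀ (V : Opens (FullSpec A)) (r : sections A V),
      IdealSheaf.chartRing e V r ∈ I.ideal (IdealSheaf.chartOpen e V) ↔ r ∈ J.ideal V) :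
    J.IsRestriction (chartMap e) I := by
  intro W hW s
  have e1 : (IdealSheaf.chartOpen e ((Opens.map (chartMap e).hom.base).obj W) : Set X) = W :=
    (chartOpen_eq e _).trans (Set.image_preimage_eq_of_subset hW)
  have i : IdealSheaf.chartOpen e ((Opens.map (chartMap e).hom.base).obj W) ⟶ W :=
    homOfLE e1.subset
  have i' : W ⟶ IdealSheaf.chartOpen e ((Opens.map (chartMap e).hom.base).obj W) :=
    homOfLE e1.superset
  refine Iff.trans ?_ (h _ _)
  rw [chartRing_sectionHom e W i s]
  refine ⟨fun hs => I.map_mem i s hs, fun hs => ?_⟩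
  have := I.map_mem i' _ hs
  have e2 : X.presheaf.map i'.op (X.presheaf.map i.op s) = s :=
    (ConcreteCategory.congr_hom (X.presheaf.map_comp i.op i'.op) s).symm.trans
      (ConcreteCategory.congr_hom (X.presheaf.map_id (op W)) s)
  rwa [e2] at this

end Charts

/-! ### Quasi-coherent ideals on charts -/

section Hat

variable {A : RingCat.{u}} (N : Type u) [AddCommGroup N] [Module A N] [Module Aᵐᵒᵖ N]

theorem biextMap_mk {B B' : Type u} [Ring B] [Ring B'] (φ : A →+* B) (ψ : A →+* B') (h : B →+* B')
    (hh : h.comp φ = ψ) (b : B) (n : N) (c : B) :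
    biextMap N φ ψ h hh (biextMk N φ b n c) = biextMk N ψ (h b) n (h c) := rfl

theorem biextMap_comp {B B' B'' : Type u} [Ring B] [Ring B'] [Ring B''] (φ : A →+* B)
    (φ' : A →+* B') (φ'' : A →+* B'') (h : B →+* B') (hh : h.comp φ = φ') (k : B' →+* B'')
    (hk : k.comp φ' = φ'') (l : B →+* B'') (hl : l.comp φ = φ'') (hkl : k.comp h = l)
    (x : Biext N φ) :
    biextMap N φ' φ'' k hk (biextMap N φ φ' h hh x) = biextMap N φ φ'' l hl x := by
  subst hkl
  exact DFunLike.congr_fun (f := (biextMap N φ' φ'' k hk).comp (biextMap N φ φ' h hh))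
    (g := biextMap N φ φ'' (k.comp h) hl) (biext_hom_ext N φ fun _ _ _ => rfl) x

theorem biext_induction {B : Type u} [Ring B] (φ : A →+* B) {P : Biext N φ → Prop}
    (zero : P 0) (add : ∀ x y, P x → P y → P (x + y)) (mk : ∀ b n c, P (biextMk N φ b n c))
    (x : Biext N φ) : P x := by
  obtain ⟨x, rfl⟩ := QuotientAddGroup.mk'_surjective (biextRel N φ) x
  induction x using TensorProduct.induction_on with
  | zero => rw [map_zero]; exact zero
  | add x y hx hy => rw [map_add]; exact add _ _ hx hy
  | tmul b y =>
    induction y using TensorProduct.induction_on with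
    | zero => rw [TensorProduct.tmul_zero, map_zero]; exact zero
    | add x y hx hy => rw [TensorProduct.tmul_add, map_add]; exact add _ _ hx hy
    | tmul n c => exact mk b n c

/-- The global section `1 ⊗ n ⊗ 1` of `N̂`. -/
def hatGlobal (n : N) : hatSections N (⊤ : Opens (FullSpec A)) :=
  ⟨fun a => biextMk N a.1.map 1 n 1, fun a b h hh => by
    rw [biextMap_mk, map_one]⟩

/-- The section of `N̂` over `D(𝐚)` given by an element of `A_𝐚 ⊗ N ⊗ A_𝐚`. -/
def hatSec (a : Fraction A) : Biext N a.map →+ hatSections N a.opens where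
  toFun x := ⟨fun b => biextMap N a.map b.1.map (Fraction.hom b.2) (Fraction.hom_comp_map b.2) x,
    fun b c h hh => biextMap_comp N _ _ _ _ _ _ _ _ _ (a.hom_ext (by
      rw [Fraction.hom_comp_map c.2, ← hh, ← Fraction.hom_comp_map b.2]; rfl)) x⟩
  map_zero' := Subtype.ext (funext fun _ => map_zero _)
  map_add' _ _ := Subtype.ext (funext fun _ => map_add _ _ _)

theorem hatSec_surjective (a : Fraction A) : Function.Surjective (hatSec N a) := fun s =>
  ⟨s.1 ⟨a, Set.Subset.rfl⟩, Subtype.ext (funext fun b => s.2 ⟨a, Set.Subset.rfl⟩ b _ _)⟩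

/-- Over `D(𝐚)` every pure tensor is `b · (1 ⊗ n ⊗ 1) · c` with a global section in the middle; this
is why `N̂` is generated by global sections. -/
theorem hatSec_mk (a : Fraction A) (b : a.ring) (n : N) (c : a.ring) :
    hatSec N a (biextMk N a.map b n c) = hatLeft N (sec a b)
      (hatRight N (hatRes N le_top (hatGlobal N n)) (sec a c)) :=
  Subtype.ext (funext fun d => by
    change biextMk N d.1.map (Fraction.hom d.2 b) n (Fraction.hom d.2 c) =
      biextMk N d.1.map (Fraction.hom d.2 b * 1) n (1 * Fraction.hom d.2 c)
    rw [mul_one, one_mul])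

end Hat

section QuasiCoherent

variable {X : SheafedSpace RingCat.{u}} {U : Opens X} {A : RingCat.{u}}

/-- The homomorphism `A → 𝒪_X(U)` of a chart `U ≅ F(A)`. -/
def chartGlobal (e : X.restrict U.isOpenEmbedding ≅ FSpec A) :
    A →+* X.presheaf.obj (op (IdealSheaf.chartOpen e ⊤)) :=
  (IdealSheaf.chartRing e ⊤).comp (toGlobal A)

/-- The empty fraction is initial among all fractions and has ring `A`. -/
theorem toGlobal_bijective (A : RingCat.{u}) : Function.Bijective (toGlobal A) := by
  have htop : ∀ a : Fraction A, a.D ⊆ ((⊤ : Opens (FullSpec A)) : Set (FullSpec A)) :=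
    fun a => Set.subset_univ _
  constructor
  · intro x y h
    exact congrArg (fun t : sections A ⊤ => t.1 ⟨Fraction.nil A, htop _⟩) h
  · intro s
    refine ⟨(s : sections A ⊤).1 ⟨Fraction.nil A, htop _⟩, Subtype.ext (funext fun a => ?_)⟩
    exact (s : sections A ⊤).2 ⟨Fraction.nil A, htop _⟩ a a.1.map rfl

theorem sectionsRes_toGlobal (a : Fraction A) (x : A) :
    sectionsRes A (le_top : a.opens ≤ ⊤) (toGlobal A x) = sec a (a.map x) :=
  Subtype.ext (funext fun b => (RingHom.congr_fun (Fraction.hom_comp_map b.2) x).symm)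

theorem chartRing_sec_map (e : X.restrict U.isOpenEmbedding ≅ FSpec A) (a : Fraction A) (x : A) :
    IdealSheaf.chartRing e a.opens (sec a (a.map x)) =
      X.presheaf.map (homOfLE (chartOpen_mono e le_top)).op (chartGlobal e x) := by
  rw [← sectionsRes_toGlobal]
  exact chartRing_res e le_top (toGlobal A x)

theorem chartGlobal_bijective (e : X.restrict U.isOpenEmbedding ≅ FSpec A) :
    Function.Bijective (chartGlobal e) :=
  (chartRing_bijective e ⊤).comp (toGlobal_bijective A)

/-- The ideal of `A` of global sections of `ℐ` on a chart `U ≅ F(A)`. -/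
def IdealSheaf.chartIdeal (I : IdealSheaf X) (e : X.restrict U.isOpenEmbedding ≅ FSpec A) :
    TwoSidedIdeal A := (I.ideal (IdealSheaf.chartOpen e ⊤)).comap (chartGlobal e)

namespace IdealSheaf.HatIso

variable {I : IdealSheaf X} {e : X.restrict U.isOpenEmbedding ≅ FSpec A}
  {N : Type u} [AddCommGroup N] [Module A N] [Module Aᵐᵒᵖ N]

/-- Bilinearity of `E` sends `b ⊗ n ⊗ c` to `b x c`, where `x` corresponds to the global section `1
⊗ n ⊗ 1` and so belongs to the ideal of the chart. -/
theorem exists_mem_generatedIdeal (E : I.HatIso e N) (a : Fraction A)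
    (s : hatSections N a.opens) : ∃ r ∈ generatedIdeal A (I.chartIdeal e) a.opens,
      chartRing e a.opens r = (E.equiv a.opens s : X.presheaf.obj (op (chartOpen e a.opens))) := by
  obtain ⟨y, rfl⟩ := hatSec_surjective N a s
  induction y using biext_induction with
  | zero => exact ⟨0, TwoSidedIdeal.zero_mem _, by rw [map_zero, map_zero, map_zero]; rfl⟩
  | add x y hx hy =>
    obtain ⟨r, hr, e1⟩ := hx
    obtain ⟨t, ht, e2⟩ := hy
    refine ⟨r + t, TwoSidedIdeal.add_mem _ hr ht, ?_⟩
    rw [map_add, map_add, map_add, e1, e2]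
    rfl
  | mk b n c =>
    obtain ⟨x, hx⟩ := (chartGlobal_bijective e).2 (E.equiv ⊤ (hatGlobal N n))
    have hxI : x ∈ I.chartIdeal e := by
      refine (TwoSidedIdeal.mem_comap _).2 ?_
      rw [hx]
      exact (E.equiv ⊤ (hatGlobal N n)).2
    refine ⟨sec a b * (sec a (a.map x) * sec a c), TwoSidedIdeal.mul_mem_left _ _ _
      (TwoSidedIdeal.mul_mem_right _ _ _ (sec_mem_generatedIdeal _
        (TwoSidedIdeal.subset_span ⟨x, hxI, rfl⟩))), ?_⟩
    rw [hatSec_mk, E.left, E.right, E.res le_top (homOfLE (chartOpen_mono e le_top)), map_mul,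
      map_mul, chartRing_sec_map, ← hx]

/-- Membership is tested on the sets `D(𝐚) ⊆ V`. There every section of `ℐ` comes from `N̂`, hence
from the generated ideal; conversely the generators are restrictions of global sections of `ℐ`. -/
theorem chartRing_mem_iff (E : I.HatIso e N) (V : Opens (FullSpec A)) (r : sections A V) :
    chartRing e V r ∈ I.ideal (chartOpen e V) ↔ r ∈ generatedIdeal A (I.chartIdeal e) V := by
  constructor
  · intro hr
    refine mem_generatedIdeal.2 fun a => ?_
    have ha : a.1.opens ≤ V := a.2
    have h1 := I.map_mem (homOfLE (chartOpen_mono e ha)) _ hr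
    rw [← chartRing_res e ha] at h1
    obtain ⟨t, ht, h2⟩ := E.exists_mem_generatedIdeal a.1 ((E.equiv a.1.opens).symm ⟨_, h1⟩)
    rw [AddEquiv.apply_symm_apply] at h2
    obtain rfl := (chartRing_bijective e _).1 h2
    exact mem_generatedIdeal.1 ht ⟨a.1, Set.Subset.rfl⟩
  · intro hr
    refine I.locally_mem _ _ ?_
    rintro _ ⟨u, hu, rfl⟩
    obtain ⟨a, ha, haV⟩ := Fraction.exists_mem_D_subset V.2
      (show (e.hom.hom.base u : FullSpec A) ∈ (V : Set (FullSpec A)) from hu)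
    have hV : a.opens ≤ V := haV
    refine ⟨chartOpen e a.opens, homOfLE (chartOpen_mono e hV), ⟨u, ha, rfl⟩, ?_⟩
    rw [← chartRing_res e hV, sectionsRes_eq_sec r haV]
    have h1 := mem_generatedIdeal.1 hr ⟨a, haV⟩
    have h2 : TwoSidedIdeal.span (a.map '' (I.chartIdeal e : Set A)) ≤
        (I.ideal (chartOpen e a.opens)).comap ((chartRing e a.opens).comp (sec a)) := by
      refine TwoSidedIdeal.span_le.2 ?_
      rintro _ ⟨x, hx, rfl⟩
      refine (TwoSidedIdeal.mem_comap _).2 ?_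
      rw [RingHom.comp_apply, chartRing_sec_map]
      exact I.map_mem _ _ ((TwoSidedIdeal.mem_comap _).1 hx)
    exact (TwoSidedIdeal.mem_comap ((chartRing e a.opens).comp (sec a))).1 (h2 h1)

theorem isRestriction (E : I.HatIso e N) :
    (idealSheafOf A (I.chartIdeal e)).IsRestriction (chartMap e) I :=
  isRestriction_chartMap e _ I E.chartRing_mem_iff

end IdealSheaf.HatIso

variable {I : IdealSheaf X} {e : X.restrict U.isOpenEmbedding ≅ FSpec A}
  {N : Type u} [AddCommGroup N] [Module A N] [Module Aᵐᵒᵖ N]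

/-- Any surjection with the right kernel is allowed, because on `F(A)` the chart may come from
another ring `A'` and the map needed is `A' → A → A/I`. -/
theorem IdealSheaf.HatIso.isOpenInClosed (E : I.HatIso e N) {C : RingCat.{u}} (π : A →+* C)
    (hπ : Function.Surjective π) (hker : TwoSidedIdeal.ker π = I.chartIdeal e) :
    IsOpenInClosed (FSpecMap π ≫ chartMap e) I ∧
      Set.range (FSpecMap π ≫ chartMap e).hom.base = (U : Set X) ∩ I.zeroLocus := by
  have hE := E.isRestriction
  rw [← hker] at hE
  refine ⟨hE.isOpenInClosed_comp (isOpenInClosed_FSpecMap π hπ), ?_⟩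
  rw [hE.range_comp_eq (FSpecMap π) Set.univ
    ((range_comap_eq π hπ).trans (Set.univ_inter _).symm), Set.image_univ, range_chartMap]

/-- `(Z(ℐ), 𝒪_X / ℐ)` is an F-scheme if `ℐ` is quasi-coherent. -/
theorem IdealSheaf.IsQuasiCoherent.isFScheme_closedSub (hI : I.IsQuasiCoherent) :
    IsFScheme I.closedSub := by
  rintro ⟨x, hx⟩
  obtain ⟨U, hxU, A, e, N, _, _, _, _, ⟨E⟩⟩ := hI x
  obtain ⟨H, hr⟩ := E.isOpenInClosed (quotMk A (I.chartIdeal e)) (quotMk_surjective A _)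
    (ker_quotMk A _)
  let V : Opens I.zeroLocus := ⟨_, H.isOpenEmbedding_baseMap.isOpen_range⟩
  refine ⟨V, ?_, quotRing A (I.chartIdeal e), H.nonempty_restrict_iso V rfl⟩
  obtain ⟨T, hT⟩ := hr.superset ⟨hxU, hx⟩
  exact ⟨T, Subtype.ext hT⟩

theorem FullSpec.isEmpty_of_subsingleton (A : RingCat.{u}) [Subsingleton A] :
    IsEmpty (FullSpec A) :=
  ⟨fun S => not_nontrivial A (Fraction.nontrivial_of_mem_D S.mem_D_nil)⟩

/-- For a quasi-coherent sheaf of ideals `ℐ` on `F(A)`, the ringed space `(Z(ℐ), 𝒪_A / ℐ)` is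
isomorphic to `F(A / I)`, where `I` is the ideal of global sections of `ℐ`. -/
theorem IdealSheaf.IsQuasiCoherent.nonempty_closedSub_iso {A : RingCat.{u}}
    {I : IdealSheaf (FSpec A)} (hI : I.IsQuasiCoherent) :
    Nonempty (I.closedSub ≅ FSpec (quotRing A I.globalIdeal)) := by
  -- For `A = 0` the space is empty and quasi-coherence supplies no chart, so both sides are
  -- compared directly as empty ringed spaces.
  rcases subsingleton_or_nontrivial A with hA | hA
  · have h1 : IsEmpty (FSpec A) := FullSpec.isEmpty_of_subsingleton A
    have : Subsingleton (quotRing A I.globalIdeal) :=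
      (quotMk_surjective A I.globalIdeal).subsingleton
    have h2 : IsEmpty (FSpec (quotRing A I.globalIdeal)) :=
      FullSpec.isEmpty_of_subsingleton (quotRing A I.globalIdeal)
    have H : IsOpenInClosed (FSpecMap (quotMk A I.globalIdeal)) I :=
      { injective := fun y => h2.elim y
        inducing := FullSpec.isInducing_comap _ (quotMk_surjective A _)
        exists_range_eq := ⟨Set.univ, isOpen_univ, Set.ext fun x => h1.elim x⟩
        surjective := fun y => h2.elim y
        ker := fun y => h2.elim y }
    exact H.nonempty_iso fun x => h1.elim x
  · have : Nontrivial (Fraction.nil A).ring := hA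
    -- The center of `D` of the empty fraction has no neighbourhood but the whole space, so the
    -- chart around it is all of `F(A)`.
    obtain ⟨c, -, hcen⟩ := (Fraction.nil A).exists_center
    obtain ⟨U, hcU, A', e, N, _, _, _, _, ⟨E⟩⟩ := hI c
    have hU : (U : Set (FSpec A)) = Set.univ :=
      Set.eq_univ_of_univ_subset ((Fraction.D_nil A).superset.trans (hcen U.carrier U.2 hcU))
    have hO : (IdealSheaf.chartOpen e ⊤ : Opens (FSpec A)) = ⊤ := by
      refine Opens.ext ((chartOpen_eq e ⊤).trans ?_)
      refine Set.image_univ.trans ((range_chartMap e).trans hU)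
    let i : IdealSheaf.chartOpen e ⊤ ⟶ ⊤ := homOfLE le_top
    let i' : ⊤ ⟶ IdealSheaf.chartOpen e ⊤ := homOfLE hO.ge
    have hii' : ∀ s, (FSpec A).presheaf.map i'.op ((FSpec A).presheaf.map i.op s) = s := fun s =>
      (ConcreteCategory.congr_hom ((FSpec A).presheaf.map_comp i.op i'.op) s).symm.trans
        (ConcreteCategory.congr_hom ((FSpec A).presheaf.map_id (op ⊤)) s)
    have hi'i : ∀ s, (FSpec A).presheaf.map i.op ((FSpec A).presheaf.map i'.op s) = s := fun s =>
      (ConcreteCategory.congr_hom ((FSpec A).presheaf.map_comp i'.op i.op) s).symm.trans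
        (ConcreteCategory.congr_hom ((FSpec A).presheaf.map_id (op _)) s)
    let θ : A' →+* (FSpec A).presheaf.obj (op ⊤) :=
      ((FSpec A).presheaf.map i'.op).hom.comp (chartGlobal e)
    let g := RingEquiv.ofBijective (toGlobal A) (toGlobal_bijective A)
    -- The ring `A'` of the chart is identified with `A` through global sections; only surjectivity
    -- of `τ` is needed later.
    let τ : A' →+* A := g.symm.toRingHom.comp θ
    have hτ : Function.Surjective τ := by
      intro x
      obtain ⟨y, hy⟩ := (chartGlobal_bijective e).2 ((FSpec A).presheaf.map i.op (toGlobal A x))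
      refine ⟨y, g.symm_apply_eq.2 ?_⟩
      exact (congrArg ((FSpec A).presheaf.map i'.op) hy).trans (hii' _)
    have hk : TwoSidedIdeal.ker ((quotMk A I.globalIdeal).comp τ) = I.chartIdeal e := by
      refine TwoSidedIdeal.ext fun y => ?_
      rw [TwoSidedIdeal.mem_ker, RingHom.comp_apply, ← TwoSidedIdeal.mem_ker (quotMk A _),
        ker_quotMk]
      have h1 : toGlobal A (τ y) = (FSpec A).presheaf.map i'.op (chartGlobal e y) :=
        g.apply_symm_apply _
      refine (TwoSidedIdeal.mem_comap _).trans (Iff.trans ?_ (TwoSidedIdeal.mem_comap _).symm)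
      rw [h1]
      refine ⟨fun h => ?_, fun h => I.map_mem _ _ h⟩
      have := I.map_mem i _ h
      rwa [hi'i] at this
    obtain ⟨H, hr⟩ := E.isOpenInClosed _ ((quotMk_surjective A _).comp hτ) hk
    refine H.nonempty_iso ?_
    rw [hr, hU, Set.univ_inter]

end QuasiCoherent

end

end FSch

theorem mainTheorem9 :
    (∀ (X : SheafedSpace RingCat.{u}) (I : FSch.IdealSheaf X),
      FSch.IsFScheme X → I.IsQuasiCoherent → FSch.IsFScheme I.closedSub) ∧
    (∀ (A : RingCat.{u}) (I : FSch.IdealSheaf (FSch.FSpec A)), I.IsQuasiCoherent →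
      Nonempty (I.closedSub ≅ FSch.FSpec (FSch.quotRing A I.globalIdeal))) ∧
    (∀ (A : RingCat.{u}) (I : TwoSidedIdeal A),
      Nonempty ((FSch.idealSheafOf A I).closedSub ≅ FSch.FSpec (FSch.quotRing A I))) :=
  ⟨fun _ _ _ hI => hI.isFScheme_closedSub, fun _ _ hI => hI.nonempty_closedSub_iso,
    FSch.nonempty_closedSub_idealSheafOf_iso⟩
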